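/- Let $S$ be a finite set with a total order $<$, let $R$ be a commutative ring with $1$, and let $A=R\langle t_s\mid s\in S\rangle$ be the free associative algebra. For $J=\{j_1<\dots<j_n\}\subseteq S$ put $t_J=t_{j_1}\cdots t_{j_n}$. For a set $\mathfrak N$ of subsets of $S$ and $q\in R$, let $G_q(\mathfrak N)\subseteq A$ be the set of the elements $$t_s^2-q\ (s\in S),\qquad t_rt_s+t_st_r-2q\ (r,s\in S,\ s<r),\qquad \sum_{I\subseteq J,\ \#I\text{ odd}}(-1)^{\ell_J(I)}(-q)^{(\#I-1)/2}\,t_{J\setminus I}\ (J\in\mathfrak N),$$ where $\ell_J(I)=\sum_{\nu=1}^{k}(\alpha_\nu-\nu)$ for $I=\{j_{\alpha_1}<\dots<j_{\alpha_k}\}\subseteq J=\{j_1<\dots<j_n\}$. Let $I_q(\mathfrak N)$ be the two-sided ideal of $A$ generated by $G_q(\mathfrak N)$ and $\mathrm{OS}_q(\mathfrak N)=A/I_q(\mathfrak N)$. Let $\mathfrak M$ be the set of circuits of a matroid on $S$ without loops and without parallel elements. A subset of $S$ is dependent if it contains a circuit; a broken circuit is a circuit with its least element removed. Monomials are compared by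 the degree lexicographic order (first by degree, then lexicographically from the left with respect to $<$), and subsets $J$ of $S$ through the monomials $t_J$. The set $\overline{\mathfrak M}$ of Gröbner circuits is defined recursively along this order: a dependent set $J$ belongs to $\overline{\mathfrak M}$ if and only if there is no $K\in\overline{\mathfrak M}$ strictly smaller than $J$ such that $K\setminus\{\min K\}$ is a convex subset of $J\setminus\{\min J\}$ (a subset $K'\subseteq J'$ is convex if every $j\in J'$ with $k<j<k'$ for some $k,k'\in K'$ lies in $K'$). A subset $G$ of a two-sided ideal $I$ of $A$ is a Gröbner basis of $I$ if the leading terms of the elements of $G$ generate the same two-sided ideal as the leading terms of the elements of $I$; the standard monomials with respect to $G$ are the monomials that do not contain the leading monomial of an element of $G$ as a factor (contiguous subword). Then: 1. There is a natural number $n$ such that for every $q\in R$ the algebra $\mathrm{OS}_q(\mathfrak M)$ is a free $R$-module of rank $n$; that is, it is free and its rank is independent of $q$. 2. For every $q\in R$ the set $G_q(\overline{\mathfrak M})$ is a Gröbner basis of $I_q(\mathfrak M)$, and, if $R\neq 0$, the standard monomials with respect to it are exactly the monomials $t_J$ for those $J\subseteq S$ that do not contain a broken circuit. -/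

import Mathlib

noncomputable section

namespace OSDeform

universe u v

variable (R : Type u) [CommRing R] {S : Type v} [LinearOrder S]

/-- The free associative algebra `R⟨t_s | s ∈ S⟩` of non-commutative polynomials, realised as the
monoid algebra of the free monoid on `S`: its monomials are the words in the alphabet `S`, and
`f.coeff w` is the coefficient of the word `w` in `f`. -/
abbrev NCPoly (S : Type v) : Type (max u v) := MonoidAlgebra R (FreeMonoid S)

/-- The variable `t_s`. -/
def t (s : S) : NCPoly R S := MonoidAlgebra.of R (FreeMonoid S) (FreeMonoid.of s)

/-- The word `j₁ j₂ ⋯ jₙ` attached to a subset `J = {j₁ < j₂ < ⋯ < jₙ}` of `S`. -/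
def word (J : Finset S) : FreeMonoid S := FreeMonoid.ofList (J.sort (· ≤ ·))

/-- The monomial `t_J = t_{j₁} t_{j₂} ⋯ t_{jₙ}` for `J = {j₁ < j₂ < ⋯ < jₙ}`. -/
def tSet (J : Finset S) : NCPoly R S := MonoidAlgebra.of R (FreeMonoid S) (word J)

/-- For `I = {j_{α₁} < ⋯ < j_{αₖ}} ⊆ J = {j₁ < ⋯ < jₙ}` this is `∑ ν, (α_ν - ν)`: for `i = j_{α_ν}`,
the position `α_ν` of `i` in `J` is the number of `j ∈ J` with `j ≤ i`, and the position `ν` of `i`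
in `I` is the number of `j ∈ I` with `j ≤ i`. As `I ⊆ J`, the subtraction does not truncate. -/
def ell (J I : Finset S) : ℕ :=
  ∑ i ∈ I, ((J.filter (· ≤ i)).card - (I.filter (· ≤ i)).card)

variable {R}

/-- The deformed relation
`∑_{I ⊆ J, #I odd} (-1)^{ℓ_J(I)} (-q)^{(#I-1)/2} t_{J ∖ I}`. -/
def tm (q : R) (J : Finset S) : NCPoly R S :=
  ∑ I ∈ J.powerset.filter (fun I => Odd I.card),
    ((-1 : R) ^ ell J I * (-q) ^ ((I.card - 1) / 2)) • tSet R (J \ I)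

/-- The set of generators attached to a set system `𝔐` on `S`. -/
def generators (q : R) (𝔐 : Set (Finset S)) : Set (NCPoly R S) :=
  {f | ∃ s : S, f = t R s ^ 2 - algebraMap R (NCPoly R S) q} ∪
  {f | ∃ r s : S, s < r ∧
    f = t R r * t R s + t R s * t R r - algebraMap R (NCPoly R S) (2 * q)} ∪
  {f | ∃ J ∈ 𝔐, f = tm q J}

/-- The two-sided ideal `I_q(𝔐)`. -/
def idealQ (q : R) (𝔐 : Set (Finset S)) : TwoSidedIdeal (NCPoly R S) :=
  TwoSidedIdeal.span (generators q 𝔐)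

/-- The algebra `OS_q(𝔐)`, the quotient of the free algebra by `I_q(𝔐)`. -/
abbrev OS (q : R) (𝔐 : Set (Finset S)) : Type (max u v) := (idealQ q 𝔐).ringCon.Quotient

/-! ### Monomial order, leading terms, Gröbner bases, standard monomials -/

/-- The degree lexicographic order on words (strict). -/
def DegLex (v w : FreeMonoid S) : Prop :=
  List.Shortlex (· < ·) (FreeMonoid.toList v) (FreeMonoid.toList w)

/-- `w` is the leading monomial of `f` (no word is a leading monomial of `0`). -/
def IsLeadingMonomial (f : NCPoly R S) (w : FreeMonoid S) : Prop :=
  f.coeff w ≠ 0 ∧ ∀ v : FreeMonoid S, f.coeff v ≠ 0 → v ≠ w → DegLex v w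

/-- The set of leading terms `lt(f)` of the non-zero elements `f` of `F`. -/
def leadingTerms (F : Set (NCPoly R S)) : Set (NCPoly R S) :=
  {g | ∃ f ∈ F, ∃ w, IsLeadingMonomial f w ∧ g = MonoidAlgebra.single w (f.coeff w)}

/-- `G` is a Gröbner basis of the two-sided ideal `I`: it is contained in `I`, and the leading terms
of `G` generate the same two-sided ideal as the leading terms of `I`. -/
def IsGroebnerBasis (G : Set (NCPoly R S)) (I : TwoSidedIdeal (NCPoly R S)) : Prop :=
  G ⊆ {f | f ∈ I} ∧
    TwoSidedIdeal.span (leadingTerms G) = TwoSidedIdeal.span (leadingTerms {f | f ∈ I})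

/-- The standard monomials with respect to `G`: the words that do not have the leading monomial of
an element of `G` as a factor. -/
def standardMonomials (G : Set (NCPoly R S)) : Set (FreeMonoid S) :=
  {w | ∀ g ∈ G, ∀ m, IsLeadingMonomial g m → ¬ ∃ a b : FreeMonoid S, w = a * m * b}

/-! ### Broken circuits and Gröbner circuits -/

/-- `J ∖ {j₁}`, the set `J` with its least element removed (and `∅` for `J = ∅`). -/
def removeMin (J : Finset S) : Finset S := J.filter (fun x => ∃ y ∈ J, y < x)

/-- The degree lexicographic order on finite subsets, induced from that on the monomials `t_J`. -/
def SetDegLex (J K : Finset S) : Prop := DegLex (word J) (word K)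

/-- `K` is a convex subset of `J`. -/
def IsConvexSubset (K J : Finset S) : Prop :=
  K ⊆ J ∧ ∀ j ∈ J, ∀ k ∈ K, ∀ k' ∈ K, k < j → j < k' → j ∈ K

/-- `J` is dependent: it contains a member of `𝔐` (the set of circuits). -/
def Dependent (𝔐 : Set (Finset S)) (J : Finset S) : Prop := ∃ C ∈ 𝔐, C ⊆ J

/-- A broken circuit: a circuit with its least element removed. -/
def IsBrokenCircuit (𝔐 : Set (Finset S)) (B : Finset S) : Prop := ∃ C ∈ 𝔐, B = removeMin C

theorem setDegLex_wf [Finite S] : WellFounded (SetDegLex (S := S)) :=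
  InvImage.wf (fun J : Finset S => FreeMonoid.toList (word J))
    (List.Shortlex.wf (wellFounded_lt (α := S)))

/-- Gröbner circuits, by recursion along the degree lexicographic order on subsets; the recursive
characterisation is `isGroebnerCircuit_iff`. -/
def IsGroebnerCircuit [Finite S] (𝔐 : Set (Finset S)) : Finset S → Prop :=
  (setDegLex_wf (S := S)).fix fun J rec =>
    Dependent 𝔐 J ∧ ∀ (K : Finset S) (h : SetDegLex K J), rec K h →
      ¬ IsConvexSubset (removeMin K) (removeMin J)

theorem isGroebnerCircuit_iff [Finite S] (𝔐 : Set (Finset S)) (J : Finset S) :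
    IsGroebnerCircuit 𝔐 J ↔ Dependent 𝔐 J ∧ ∀ K : Finset S, IsGroebnerCircuit 𝔐 K →
      SetDegLex K J → ¬ IsConvexSubset (removeMin K) (removeMin J) := by
  rw [IsGroebnerCircuit, WellFounded.fix_eq]
  exact and_congr_right fun _ => forall_congr' fun K => forall_comm

/-- The set of Gröbner circuits. -/
def groebnerCircuits [Finite S] (𝔐 : Set (Finset S)) : Set (Finset S) :=
  {J | IsGroebnerCircuit 𝔐 J}

/-! ### Matroids -/

/-- The set system of circuits of a matroid on `S`. -/
def circuits (M : Matroid S) : Set (Finset S) := {C | M.IsCircuit (C : Set S)}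

/-- `M` has no parallel elements: no two distinct elements form a circuit. -/
def NoParallel (M : Matroid S) : Prop := ∀ e f : S, e ≠ f → ¬ M.IsCircuit {e, f}

end OSDeform

end

/-!
For every `q` the ideal contains the squares of the differences `t_r - t_s`, modulo the ideal these
differences anticommute, and modulo `t_s² = q` the relation `tm q J` is the product `(t_{j₂} -
t_{j₁}) ⋯ (t_{jₙ} - t_{jₙ₋₁})` of successive differences (`map_tm`). This product is only multiplied
by a further factor when elements are added to `J`, so the relations of all dependent sets, and with
them those of the Gröbner circuits, lie in the ideal (`generators_groebnerCircuits_subset`).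

The leading monomials of the generators have coefficient `1`; the words that avoid them are the
words of the sets without broken circuits (`standardMonomials_generators_groebnerCircuits`).
Reduction shows that these words span the quotient. Both the basis and the Gröbner property then
follow once the standard words are known to be linearly independent modulo the ideal
(`nonempty_basis_standardMonomials`, `isGroebnerBasis_of_independent`).

For the independence (`eq_zero_of_mem_idealQ`), let `v_s` be vectors and `d` a linear form with `d
(v_s) = 1` for all `s`. The operators `x ↦ v_s ∧ x + q (d ⌋ x)` on the exterior algebra satisfy the
quadratic relations. The relation of `C` acts as multiplication by `d ⌋ (v_{c₁} ∧ ⋯ ∧ v_{cₙ})`,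
because the contraction cancels in differences, so it acts as zero as soon as two of the `v_c`
coincide. For a set `J = {j₁ < ⋯ < j_k}` without broken circuits, let `v_s` record which of the
flats spanned by `{j_i, …, j_k}` contain `s`. No circuit is separated completely by a chain of
flats, so the whole ideal acts as zero. The coefficient of top degree of the image of `1` under a
word of length `k` is the determinant of the incidences of its letters with the flats. It is `1` for
`J`, and it vanishes for every other set `K` of `k` elements without broken circuits: otherwise `K`
meets each of the flats in a spanning set, and therefore contains its least element, which is `j_i`.
Hence a combination of standard words in the ideal has zero coefficients in its highest degree.
-/

namespace OSDeform

/-! ### Products of successive differences -/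

section Chain

variable {B : Type*} [Ring B] {S : Type*}

/-- The product `(t_{j₂} - t_{j₁}) (t_{j₃} - t_{j₂}) ⋯ (t_{jₙ} - t_{jₙ₋₁})` of the successive
differences along the list `j₁, …, jₙ`; it is `0` for the empty list and `1` for a list of length
one, in accordance with `tm`. -/
def chainProd (t : S → B) : List S → B
  | [] => 0
  | [_] => 1
  | x :: y :: l => (t y - t x) * chainProd t (y :: l)

theorem map_chainProd {B' : Type*} [Ring B'] (f : B →+* B') (t : S → B) :
    ∀ l : List S, f (chainProd t l) = chainProd (fun s => f (t s)) l
  | [] => map_zero f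
  | [_] => map_one f
  | x :: y :: l => by
    rw [chainProd, chainProd, map_mul, map_sub, map_chainProd f t (y :: l)]

/-- Moving a factor that anticommutes with the members of a list to the end of their product. -/
theorem exists_mul_prod_eq_prod_mul {u : S → B} (huu : ∀ x y, u x * u y = -(u y * u x)) (y : S)
    (l : List S) : ∃ c, u y * (l.map u).prod = (l.map u).prod * c := by
  induction l with
  | nil => exact ⟨u y, by simp⟩
  | cons z l ih =>
    obtain ⟨c, hc⟩ := ih
    refine ⟨-c, ?_⟩
    rw [List.map_cons, List.prod_cons, ← mul_assoc, huu, neg_mul, mul_assoc, hc, mul_neg, mul_assoc]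

theorem exists_prod_eq_prod_mul_of_sublist {u : S → B} (huu : ∀ x y, u x * u y = -(u y * u x))
    {l' l : List S} (h : l'.Sublist l) : ∃ c, (l.map u).prod = (l'.map u).prod * c := by
  induction h with
  | slnil => exact ⟨1, by simp⟩
  | cons y _ ih =>
    obtain ⟨c, hc⟩ := ih
    obtain ⟨d, hd⟩ := exists_mul_prod_eq_prod_mul huu y _
    exact ⟨d * c, by rw [List.map_cons, List.prod_cons, hc, ← mul_assoc, hd, mul_assoc]⟩
  | cons_cons y _ ih =>
    obtain ⟨c, hc⟩ := ih
    exact ⟨c, by rw [List.map_cons, List.prod_cons, hc, List.map_cons, List.prod_cons, mul_assoc]⟩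

/-- If the differences of the `t_s` square to zero and anticommute, the successive differences in
`chainProd` may be replaced by the differences with the head of the list. -/
theorem chainProd_cons {t : S → B} (hsq : ∀ x y, (t x - t y) * (t x - t y) = 0)
    (hanti : ∀ a x y, (t x - t a) * (t y - t a) = -((t y - t a) * (t x - t a))) (a : S)
    (l : List S) : chainProd t (a :: l) = (l.map fun y => t y - t a).prod := by
  have key : ∀ (l : List S) (a y : S), (t y - t a) * (l.map fun z => t z - t y).prod =
      (t y - t a) * (l.map fun z => t z - t a).prod := by
    intro l a y
    induction l with
    | nil => rfl
    | cons z l ih =>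
      have h : (t y - t a) * (t z - t y) = -((t z - t a) * (t y - t a)) := by
        have : t z - t y = (t z - t a) - (t y - t a) := by abel
        rw [this, mul_sub, hsq, sub_zero, hanti]
      rw [List.map_cons, List.prod_cons, List.map_cons, List.prod_cons, ← mul_assoc, h, neg_mul,
        mul_assoc, ih, ← mul_assoc, ← neg_mul, ← hanti, mul_assoc]
  induction l generalizing a with
  | nil => rfl
  | cons y l ih => rw [chainProd, ih y, key, List.map_cons, List.prod_cons]

theorem chainProd_eq_zero_of_sublist {t : S → B} (hsq : ∀ x y, (t x - t y) * (t x - t y) = 0)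
    (hanti : ∀ a x y, (t x - t a) * (t y - t a) = -((t y - t a) * (t x - t a)))
    {l' l : List S} (h : l'.Sublist l) (hne : l' ≠ []) (h0 : chainProd t l' = 0) :
    chainProd t l = 0 := by
  -- It suffices to compare two lists with the same head.
  have key : ∀ (a : S) (l' l : List S), l'.Sublist l → chainProd t (a :: l') = 0 →
      chainProd t (a :: l) = 0 := by
    intro a l' l h h0
    obtain ⟨c, hc⟩ := exists_prod_eq_prod_mul_of_sublist (hanti a) h
    rw [chainProd_cons hsq hanti] at h0 ⊢
    rw [hc, h0, zero_mul]
  obtain ⟨b, m', rfl⟩ := List.exists_cons_of_ne_nil hne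
  cases l with
  | nil => simp at h
  | cons a m =>
    cases h with
    | cons _ h => exact key a _ _ h (by rw [chainProd, h0, mul_zero])
    | cons_cons _ h => exact key b _ _ h h0

end Chain

/-! ### The deformed relation as a product of differences -/

section Expansion

variable {R : Type*} [CommRing R] {S : Type*} [LinearOrder S]

theorem ell_insert_of_lt {x : S} {J I : Finset S} (hx : ∀ y ∈ J, x < y) (hI : I ⊆ J) :
    ell (insert x J) I = ell J I + I.card := by
  rw [ell, ell, Finset.card_eq_sum_ones, ← Finset.sum_add_distrib]
  refine Finset.sum_congr rfl fun i hi => ?_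
  have hxi := hx i (hI hi)
  have hxJ : x ∉ J := fun h => (hx x h).false
  rw [Finset.filter_insert, if_pos hxi.le, Finset.card_insert_of_notMem (by simp [hxJ])]
  have := Finset.card_le_card (Finset.filter_subset_filter (· ≤ i) hI)
  omega

theorem ell_insert_insert {x : S} {J I : Finset S} (hx : ∀ y ∈ J, x < y) (hI : I ⊆ J) :
    ell (insert x J) (insert x I) = ell J I := by
  have hxJ : x ∉ J := fun h => (hx x h).false
  have hxI : x ∉ I := fun h => hxJ (hI h)
  have h1 : ∀ K ⊆ J, K.filter (· ≤ x) = ∅ := fun K hK =>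
    Finset.filter_eq_empty_iff.2 fun y hy => not_le.2 (hx y (hK hy))
  rw [ell, ell, Finset.sum_insert hxI, Finset.filter_insert, Finset.filter_insert, if_pos le_rfl,
    if_pos le_rfl, h1 J subset_rfl, h1 I hI, Nat.sub_self, zero_add]
  refine Finset.sum_congr rfl fun i hi => ?_
  have hxi := hx i (hI hi)
  rw [Finset.filter_insert, Finset.filter_insert, if_pos hxi.le, if_pos hxi.le,
    Finset.card_insert_of_notMem (by simp [hxJ]), Finset.card_insert_of_notMem (by simp [hxI])]
  omega

theorem sort_insert_of_lt {x : S} {J : Finset S} (hx : ∀ y ∈ J, x < y) :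
    (insert x J).sort (· ≤ ·) = x :: J.sort (· ≤ ·) :=
  Finset.sort_insert _ (fun y hy => (hx y hy).le) fun h => (hx x h).false

theorem word_insert {x : S} {J : Finset S} (hx : ∀ y ∈ J, x < y) :
    word (insert x J) = FreeMonoid.of x * word J := by
  rw [word, sort_insert_of_lt hx]
  rfl

theorem tSet_insert {x : S} {J : Finset S} (hx : ∀ y ∈ J, x < y) :
    tSet R (insert x J) = t R x * tSet R J := by
  rw [tSet, word_insert hx, map_mul]
  rfl

/-- The counterpart of `tm` whose sum runs over the subsets of even cardinality. -/
noncomputable def tmEven (q : R) (J : Finset S) : NCPoly R S :=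
  ∑ I ∈ J.powerset.filter (fun I => Even I.card),
    ((-1 : R) ^ ell J I * (-q) ^ (I.card / 2)) • tSet R (J \ I)

/-- Separating the subsets of `insert x J` according to whether they contain `x`. -/
theorem tm_insert (q : R) {x : S} {J : Finset S} (hx : ∀ y ∈ J, x < y) :
    tm q (insert x J) = tmEven q J - t R x * tm q J := by
  have hxJ : x ∉ J := fun h => (hx x h).false
  rw [tm, tm, tmEven, Finset.sum_filter, Finset.sum_powerset_insert hxJ, Finset.sum_filter,
    Finset.sum_filter, add_comm, sub_eq_add_neg, Finset.mul_sum, ← Finset.sum_neg_distrib]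
  congr 1 <;> refine Finset.sum_congr rfl fun I hI => ?_ <;>
    have hI' := Finset.mem_powerset.1 hI <;>
    have hxI : x ∉ I := fun h => hxJ (hI' h)
  · simp only [Finset.card_insert_of_notMem hxI, Nat.odd_add_one, Nat.not_odd_iff_even]
    rw [ell_insert_insert hx hI', Nat.add_sub_cancel, Finset.insert_sdiff_insert,
      Finset.sdiff_insert_of_notMem hxJ]
  · split_ifs with h
    · rw [ell_insert_of_lt hx hI', Finset.insert_sdiff_of_notMem _ hxI,
        tSet_insert fun y hy => hx y (Finset.mem_sdiff.1 hy).1, pow_add, h.neg_one_pow,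
        mul_smul_comm, ← neg_smul]
      congr 1
      ring
    · rw [mul_zero, neg_zero]

theorem tmEven_insert (q : R) {x : S} {J : Finset S} (hx : ∀ y ∈ J, x < y) :
    tmEven q (insert x J) = t R x * tmEven q J - q • tm q J := by
  have hxJ : x ∉ J := fun h => (hx x h).false
  rw [tm, tmEven, tmEven, Finset.sum_filter, Finset.sum_powerset_insert hxJ, Finset.sum_filter,
    Finset.sum_filter, sub_eq_add_neg, Finset.mul_sum, Finset.smul_sum, ← Finset.sum_neg_distrib]
  congr 1 <;> refine Finset.sum_congr rfl fun I hI => ?_ <;>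
    have hI' := Finset.mem_powerset.1 hI <;>
    have hxI : x ∉ I := fun h => hxJ (hI' h)
  · split_ifs with h
    · rw [ell_insert_of_lt hx hI', Finset.insert_sdiff_of_notMem _ hxI,
        tSet_insert fun y hy => hx y (Finset.mem_sdiff.1 hy).1, pow_add, h.neg_one_pow,
        mul_smul_comm, mul_one]
    · rw [mul_zero]
  · simp only [Finset.card_insert_of_notMem hxI, Nat.even_add_one, Nat.not_even_iff_odd]
    rw [ell_insert_insert hx hI', Finset.insert_sdiff_insert, Finset.sdiff_insert_of_notMem hxJ]
    split_ifs with h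
    · obtain ⟨m, hm⟩ := h
      rw [hm, show (2 * m + 1 + 1) / 2 = m + 1 by omega, show (2 * m + 1 - 1) / 2 = m by omega,
        smul_smul, ← neg_smul]
      congr 1
      ring
    · rw [smul_zero, neg_zero]

variable {B : Type*} [Ring B] [Algebra R B]

/-- As soon as `t_s² = q`, the deformed relation `tm q J` becomes the product of the successive
differences of the `t_j`, `j ∈ J`, and its even counterpart is the same product multiplied from the
left by the variable of the least element. -/
theorem map_tm_and_map_tmEven (φ : NCPoly R S →ₐ[R] B) {q : R}
    (hsq : ∀ s, φ (t R s) * φ (t R s) = algebraMap R B q) (J : Finset S) :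
    φ (tm q J) = chainProd (fun s => φ (t R s)) (J.sort (· ≤ ·)) ∧
      ∀ x l, J.sort (· ≤ ·) = x :: l → φ (tmEven q J) = φ (t R x) * φ (tm q J) := by
  induction J using Finset.induction_on_min with
  | empty => simp [tm, chainProd, Finset.filter_singleton]
  | insert x J hx ih =>
    rw [sort_insert_of_lt hx]
    obtain ⟨ih1, ih2⟩ := ih
    rw [tm_insert q hx, tmEven_insert q hx, map_sub, map_sub, map_mul, map_mul, map_smul]
    rcases hl : J.sort (· ≤ ·) with _ | ⟨y, l⟩
    · have hJ : J = ∅ := by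
        rw [← Finset.card_eq_zero, ← Finset.length_sort (· ≤ ·), hl, List.length_nil]
      subst hJ
      have h1 : tm q (∅ : Finset S) = 0 := by simp [tm, Finset.filter_singleton]
      have h2 : tmEven q (∅ : Finset S) = 1 := by
        simp [tmEven, Finset.filter_singleton, ell, tSet, word, MonoidAlgebra.one_def]
      rw [h1, h2, map_zero, map_one, mul_zero, sub_zero, smul_zero, sub_zero, mul_one]
      exact ⟨rfl, fun x' l' h => by rw [(List.cons.inj h).1, mul_one]⟩
    · rw [hl] at ih1
      rw [ih2 y l hl]
      refine ⟨by rw [chainProd, ← ih1, sub_mul], fun x' l' h => ?_⟩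
      rw [← (List.cons.inj h).1, mul_sub, ← mul_assoc (φ (t R x)) (φ (t R x)), hsq,
        Algebra.smul_def]

theorem map_tm (φ : NCPoly R S →ₐ[R] B) {q : R}
    (hsq : ∀ s, φ (t R s) * φ (t R s) = algebraMap R B q) (J : Finset S) :
    φ (tm q J) = chainProd (fun s => φ (t R s)) (J.sort (· ≤ ·)) :=
  (map_tm_and_map_tmEven φ hsq J).1

theorem sort_sublist_sort {C J : Finset S} (h : C ⊆ J) :
    (C.sort (· ≤ ·)).Sublist (J.sort (· ≤ ·)) :=
  List.sublist_of_subperm_of_pairwise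
    ((Finset.sort_nodup _ _).subperm fun x hx => by simpa using h (by simpa using hx))
    (Finset.pairwise_sort _ _) (Finset.pairwise_sort _ _)

/-- The relation of a superset of `C` follows from the relation of `C`. -/
theorem map_tm_eq_zero_of_subset (φ : NCPoly R S →ₐ[R] B) {q : R}
    (hsq : ∀ s, φ (t R s) * φ (t R s) = algebraMap R B q)
    (hcomm : ∀ r s, φ (t R r) * φ (t R s) + φ (t R s) * φ (t R r) = algebraMap R B (2 * q))
    {C J : Finset S} (hC : C.Nonempty) (h : C ⊆ J) (h0 : φ (tm q C) = 0) : φ (tm q J) = 0 := by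
  have h2 : algebraMap R B (2 * q) = algebraMap R B q + algebraMap R B q := by
    rw [two_mul, map_add]
  set u := fun s => φ (t R s) with hu
  have hsub : ∀ x y, (u x - u y) * (u x - u y) = 0 := fun x y =>
    calc (u x - u y) * (u x - u y) = u x * u x + u y * u y - (u x * u y + u y * u x) := by
          noncomm_ring
      _ = 0 := by rw [hu, hsq, hsq, hcomm, h2, sub_self]
  have hanti : ∀ a x y, (u x - u a) * (u y - u a) = -((u y - u a) * (u x - u a)) :=
    fun a x y => eq_neg_of_add_eq_zero_left <|
    calc (u x - u a) * (u y - u a) + (u y - u a) * (u x - u a) =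
          u x * u y + u y * u x + (u a * u a + u a * u a) - (u x * u a + u a * u x) -
            (u y * u a + u a * u y) := by
          noncomm_ring
      _ = 0 := by rw [hu, hsq, hcomm, hcomm, hcomm, h2]; abel
  rw [map_tm φ hsq] at h0 ⊢
  refine chainProd_eq_zero_of_sublist hsub hanti (sort_sublist_sort h) ?_ h0
  intro h'
  rw [← List.length_eq_zero_iff, Finset.length_sort, Finset.card_eq_zero] at h'
  exact hC.ne_empty h'

end Expansion

/-! ### The Clifford action on the exterior algebra -/

section CliffordAction

variable {R : Type*} [CommRing R] {S : Type*} {V : Type*} [AddCommGroup V] [Module R V]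

/-- The contraction of the exterior algebra of `V` with a linear form `d`. -/
noncomputable def contraction (d : Module.Dual R V) : Module.End R (ExteriorAlgebra R V) :=
  CliffordAlgebra.contractLeft (Q := (0 : QuadraticForm R V)) d

theorem contraction_ι_mul (d : Module.Dual R V) (a : V) (x : ExteriorAlgebra R V) :
    contraction d (ExteriorAlgebra.ι R a * x) =
      d a • x - ExteriorAlgebra.ι R a * contraction d x :=
  CliffordAlgebra.contractLeft_ι_mul (d := d) a x

theorem contraction_contraction (d : Module.Dual R V) (x : ExteriorAlgebra R V) :
    contraction d (contraction d x) = 0 :=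
  CliffordAlgebra.contractLeft_contractLeft (d := d) x

theorem contraction_one (d : Module.Dual R V) : contraction d (1 : ExteriorAlgebra R V) = 0 :=
  CliffordAlgebra.contractLeft_one (d := d) _

/-- The operator `x ↦ v ∧ x + q (d ⌋ x)` on the exterior algebra. -/
noncomputable def cliffordOp (d : Module.Dual R V) (q : R) (v : V) :
    Module.End R (ExteriorAlgebra R V) :=
  LinearMap.mulLeft R (ExteriorAlgebra.ι R v) + q • contraction d

theorem cliffordOp_apply (d : Module.Dual R V) (q : R) (v : V) (x : ExteriorAlgebra R V) :
    cliffordOp d q v x = ExteriorAlgebra.ι R v * x + q • contraction d x := rfl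

theorem cliffordOp_mul_self {d : Module.Dual R V} (q : R) {v : V} (hv : d v = 1) :
    cliffordOp d q v * cliffordOp d q v = algebraMap R _ q := by
  refine LinearMap.ext fun x => ?_
  simp only [Module.End.mul_apply, cliffordOp_apply, map_add, map_smul, contraction_ι_mul,
    contraction_contraction, hv, ← mul_assoc, ExteriorAlgebra.ι_sq_zero,
    Module.algebraMap_end_apply, smul_sub, one_smul, smul_zero, zero_mul, zero_add, add_zero,
    sub_add_cancel]

theorem cliffordOp_mul_add_mul {d : Module.Dual R V} (q : R) {v w : V} (hv : d v = 1)
    (hw : d w = 1) : cliffordOp d q v * cliffordOp d q w + cliffordOp d q w * cliffordOp d q v =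
      algebraMap R _ (2 * q) := by
  refine LinearMap.ext fun x => ?_
  have h := ExteriorAlgebra.ι_add_mul_swap (R := R) v w
  simp only [LinearMap.add_apply, Module.End.mul_apply, cliffordOp_apply, map_add, map_smul,
    contraction_ι_mul, contraction_contraction, hv, hw, ← mul_assoc,
    Module.algebraMap_end_apply, smul_sub, one_smul, smul_zero, two_mul, add_zero]
  have h' : ExteriorAlgebra.ι R v * ExteriorAlgebra.ι R w * x =
      -(ExteriorAlgebra.ι R w * ExteriorAlgebra.ι R v * x) := by
    rw [← neg_mul, eq_neg_of_add_eq_zero_left h]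
  rw [h']
  abel

/-- The action of the free algebra on the exterior algebra of `V` in which `t_s` acts through
`cliffordOp d q (v s)`. If `d (v s) = 1` for all `s`, it respects the quadratic relations. -/
noncomputable def cliffordAction (d : Module.Dual R V) (q : R) (v : S → V) :
    NCPoly R S →ₐ[R] Module.End R (ExteriorAlgebra R V) :=
  MonoidAlgebra.lift R _ _ (FreeMonoid.lift fun s => cliffordOp d q (v s))

theorem cliffordAction_of (d : Module.Dual R V) (q : R) (v : S → V) (w : FreeMonoid S) :
    cliffordAction d q v (MonoidAlgebra.of R _ w) =
      FreeMonoid.lift (fun s => cliffordOp d q (v s)) w :=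
  MonoidAlgebra.lift_of _ _

theorem cliffordAction_t (d : Module.Dual R V) (q : R) (v : S → V) (s : S) :
    cliffordAction d q v (t R s) = cliffordOp d q (v s) := by
  rw [t, cliffordAction_of, FreeMonoid.lift_eval_of]

theorem chainProd_mulLeft (v : S → V) (l : List S) :
    chainProd (fun s => LinearMap.mulLeft R (ExteriorAlgebra.ι R (v s))) l =
      LinearMap.mulLeft R (chainProd (fun s => ExteriorAlgebra.ι R (v s)) l) := by
  have := map_chainProd (Algebra.lmul R (ExteriorAlgebra R V)).toRingHom
    (fun s => ExteriorAlgebra.ι R (v s)) l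
  exact this.symm

/-- The contraction of `v_{j₁} ∧ ⋯ ∧ v_{jₙ}` with a form that takes the value `1` on all `v_j` is the
product of the successive differences. -/
theorem contraction_prod_eq_chainProd {d : Module.Dual R V} {v : S → V} (hv : ∀ s, d (v s) = 1)
    (l : List S) : contraction d (l.map fun s => ExteriorAlgebra.ι R (v s)).prod =
      chainProd (fun s => ExteriorAlgebra.ι R (v s)) l := by
  have key : ∀ (l : List S) (x : S), ((x :: l).map fun s => ExteriorAlgebra.ι R (v s)).prod =
      ExteriorAlgebra.ι R (v x) * chainProd (fun s => ExteriorAlgebra.ι R (v s)) (x :: l) := by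
    intro l
    induction l with
    | nil => intro x; simp [chainProd]
    | cons y l ih =>
      intro x
      rw [List.map_cons, List.prod_cons, ih, chainProd, sub_mul, mul_sub,
        ← mul_assoc (ExteriorAlgebra.ι R (v x)) (ExteriorAlgebra.ι R (v x)),
        ExteriorAlgebra.ι_sq_zero, zero_mul, sub_zero]
  induction l with
  | nil => exact contraction_one d
  | cons x l ih =>
    rw [List.map_cons, List.prod_cons, contraction_ι_mul, hv, one_smul, ih]
    cases l with
    | nil => simp [chainProd]
    | cons y l => rw [key, chainProd, sub_mul]

theorem prod_map_ι_eq_zero {v : S → V} {l : List S} {x y : S} (hx : x ∈ l) (hy : y ∈ l)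
    (hxy : x ≠ y) (h : v x = v y) : (l.map fun s => ExteriorAlgebra.ι R (v s)).prod = 0 := by
  obtain ⟨i, rfl⟩ := List.get_of_mem hx
  obtain ⟨j, rfl⟩ := List.get_of_mem hy
  have := (ExteriorAlgebra.ιMulti R l.length).map_eq_zero_of_eq (fun i => v (l.get i)) h
    fun hij => hxy (by rw [hij])
  rw [ExteriorAlgebra.ιMulti_apply] at this
  rw [← this]
  congr 1
  conv_lhs => rw [← List.ofFn_get l, List.map_ofFn]
  rfl

/-- If `v` identifies two elements of `C`, then the deformed relation of `C` acts as zero. -/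
theorem cliffordAction_tm_eq_zero [LinearOrder S] {d : Module.Dual R V} (q : R) {v : S → V}
    (hv : ∀ s, d (v s) = 1) {C : Finset S} {x y : S} (hx : x ∈ C) (hy : y ∈ C) (hxy : x ≠ y)
    (h : v x = v y) : cliffordAction d q v (tm q C) = 0 := by
  rw [map_tm _ fun s => by rw [cliffordAction_t, cliffordOp_mul_self q (hv s)]]
  -- The contraction cancels in the differences of the operators.
  have hdiff : ∀ l : List S, chainProd (fun s => cliffordAction d q v (t R s)) l =
      chainProd (fun s => LinearMap.mulLeft R (ExteriorAlgebra.ι R (v s))) l := by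
    intro l
    induction l with
    | nil => rfl
    | cons x l ih =>
      cases l with
      | nil => rfl
      | cons y l =>
        rw [chainProd, chainProd, ih, cliffordAction_t, cliffordAction_t, cliffordOp, cliffordOp,
          add_sub_add_right_eq_sub]
  rw [hdiff, chainProd_mulLeft, ← contraction_prod_eq_chainProd hv,
    prod_map_ι_eq_zero (x := x) (y := y) (by simpa) (by simpa) hxy h, map_zero,
    LinearMap.mulLeft_zero_eq_zero]

/-- The subspace of the exterior algebra spanned by the products of fewer than `n` vectors. -/
noncomputable def degreeLT (R V : Type*) [CommRing R] [AddCommGroup V] [Module R V] (n : ℕ) :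
    Submodule R (ExteriorAlgebra R V) :=
  Submodule.span R {x | ∃ l : List V, l.length < n ∧ x = (l.map (ExteriorAlgebra.ι R)).prod}

theorem prod_mem_degreeLT {l : List V} {n : ℕ} (h : l.length < n) :
    (l.map (ExteriorAlgebra.ι R)).prod ∈ degreeLT R V n :=
  Submodule.subset_span ⟨l, h, rfl⟩

theorem degreeLT_mono {m n : ℕ} (h : m ≤ n) : degreeLT R V m ≤ degreeLT R V n :=
  Submodule.span_mono fun _ ⟨l, hl, hx⟩ => ⟨l, hl.trans_le h, hx⟩

theorem ι_mul_mem_degreeLT (v : V) {n : ℕ} {x : ExteriorAlgebra R V} (hx : x ∈ degreeLT R V n) :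
    ExteriorAlgebra.ι R v * x ∈ degreeLT R V (n + 1) := by
  induction hx using Submodule.span_induction with
  | mem x hx =>
    obtain ⟨l, hl, rfl⟩ := hx
    rw [← List.prod_cons, ← List.map_cons]
    exact prod_mem_degreeLT (by simpa)
  | zero => simp
  | add x y _ _ hx hy => rw [mul_add]; exact add_mem hx hy
  | smul c x _ hx => rw [mul_smul_comm]; exact Submodule.smul_mem _ _ hx

theorem contraction_prod_mem_degreeLT (d : Module.Dual R V) (l : List V) :
    contraction d (l.map (ExteriorAlgebra.ι R)).prod ∈ degreeLT R V l.length := by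
  induction l with
  | nil =>
    rw [List.map_nil, List.prod_nil, contraction_one]
    exact zero_mem _
  | cons a l ih =>
    rw [List.map_cons, List.prod_cons, contraction_ι_mul]
    exact sub_mem (Submodule.smul_mem _ _ (prod_mem_degreeLT (Nat.lt_succ_self _)))
      (ι_mul_mem_degreeLT a ih)

theorem contraction_mem_degreeLT (d : Module.Dual R V) {n : ℕ} {x : ExteriorAlgebra R V}
    (hx : x ∈ degreeLT R V n) : contraction d x ∈ degreeLT R V n := by
  induction hx using Submodule.span_induction with
  | mem x hx =>
    obtain ⟨l, hl, rfl⟩ := hx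
    exact degreeLT_mono hl.le (contraction_prod_mem_degreeLT d l)
  | zero => simp
  | add x y _ _ hx hy => rw [map_add]; exact add_mem hx hy
  | smul c x _ hx => rw [map_smul]; exact Submodule.smul_mem _ _ hx

/-- Up to terms of lower degree, a word acts on `1` as a product in the exterior algebra. -/
theorem cliffordAction_of_one_sub_mem (d : Module.Dual R V) (q : R) (v : S → V) (l : List S) :
    cliffordAction d q v (MonoidAlgebra.of R _ (FreeMonoid.ofList l)) 1 -
      ((l.map v).map (ExteriorAlgebra.ι R)).prod ∈ degreeLT R V l.length := by
  induction l with
  | nil =>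
    rw [cliffordAction_of, FreeMonoid.ofList_nil, map_one (FreeMonoid.lift _),
      Module.End.one_apply, List.map_nil, List.map_nil, List.prod_nil, sub_self]
    exact zero_mem _
  | cons s l ih =>
    rw [cliffordAction_of] at ih ⊢
    rw [FreeMonoid.ofList_cons, map_mul, FreeMonoid.lift_eval_of, Module.End.mul_apply,
      cliffordOp_apply]
    set x := FreeMonoid.lift (fun s => cliffordOp d q (v s)) (FreeMonoid.ofList l) 1
    set y := ((l.map v).map (ExteriorAlgebra.ι R)).prod
    have hx : x ∈ degreeLT R V (l.length + 1) := by
      rw [← sub_add_cancel x y]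
      exact add_mem (degreeLT_mono (Nat.le_succ _) ih) (prod_mem_degreeLT (by simp))
    have : ExteriorAlgebra.ι R (v s) * x + q • contraction d x -
        (((s :: l).map v).map (ExteriorAlgebra.ι R)).prod =
        ExteriorAlgebra.ι R (v s) * (x - y) + q • contraction d x := by
      rw [List.map_cons, List.map_cons, List.prod_cons, mul_sub]
      abel
    rw [this]
    exact add_mem (ι_mul_mem_degreeLT _ ih)
      (Submodule.smul_mem _ _ (contraction_mem_degreeLT d hx))

/-- The linear form on the exterior algebra that extends an alternating form in degree `k` by zero
on the other degrees. -/
noncomputable def topForm {k : ℕ} (f : V [⋀^Fin k]→ₗ[R] R) : ExteriorAlgebra R V →ₗ[R] R :=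
  ExteriorAlgebra.liftAlternating (Pi.single (M := fun i => V [⋀^Fin i]→ₗ[R] R) k f)

theorem topForm_prod_ofFn {k : ℕ} (f : V [⋀^Fin k]→ₗ[R] R) (v : Fin k → V) :
    topForm f ((List.ofFn v).map (ExteriorAlgebra.ι R)).prod = f v := by
  have := ExteriorAlgebra.liftAlternating_apply_ιMulti
    (Pi.single (M := fun i => V [⋀^Fin i]→ₗ[R] R) k f) v
  rw [ExteriorAlgebra.ιMulti_apply, Pi.single_eq_same] at this
  rw [List.map_ofFn]
  exact this

theorem topForm_eq_zero_of_mem {k : ℕ} (f : V [⋀^Fin k]→ₗ[R] R) {x : ExteriorAlgebra R V}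
    (hx : x ∈ degreeLT R V k) : topForm f x = 0 := by
  induction hx using Submodule.span_induction with
  | mem x hx =>
    obtain ⟨l, hl, rfl⟩ := hx
    have := ExteriorAlgebra.liftAlternating_apply_ιMulti
      (Pi.single (M := fun i => V [⋀^Fin i]→ₗ[R] R) k f) l.get
    rw [ExteriorAlgebra.ιMulti_apply, Pi.single_eq_of_ne hl.ne, AlternatingMap.zero_apply] at this
    rw [← this, topForm]
    conv_lhs => rw [← List.ofFn_get l, List.map_ofFn]
    rfl
  | zero => exact map_zero _
  | add x y _ _ hx hy => rw [map_add, hx, hy, add_zero]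
  | smul c x _ hx => rw [map_smul, hx, smul_zero]

theorem topForm_cliffordAction_of_length_lt (d : Module.Dual R V) (q : R) (v : S → V) {k : ℕ}
    (f : V [⋀^Fin k]→ₗ[R] R) {l : List S} (hl : l.length < k) :
    topForm f (cliffordAction d q v (MonoidAlgebra.of R _ (FreeMonoid.ofList l)) 1) = 0 := by
  refine topForm_eq_zero_of_mem f ?_
  rw [← sub_add_cancel (cliffordAction d q v _ 1) ((l.map v).map (ExteriorAlgebra.ι R)).prod]
  exact add_mem (degreeLT_mono hl.le (cliffordAction_of_one_sub_mem d q v l))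
    (prod_mem_degreeLT (by simpa))

theorem topForm_cliffordAction_ofFn (d : Module.Dual R V) (q : R) (v : S → V) {k : ℕ}
    (f : V [⋀^Fin k]→ₗ[R] R) (j : Fin k → S) :
    topForm f (cliffordAction d q v (MonoidAlgebra.of R _ (FreeMonoid.ofList (List.ofFn j))) 1) =
      f fun i => v (j i) := by
  have h := cliffordAction_of_one_sub_mem d q v (List.ofFn j)
  rw [List.length_ofFn] at h
  have := topForm_eq_zero_of_mem f h
  rw [map_sub, sub_eq_zero] at this
  rw [this, List.map_ofFn, topForm_prod_ofFn]
  rfl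

end CliffordAction

/-! ### Expansion in words -/

theorem eq_sum_smul_of {R : Type*} [CommRing R] {S : Type*} (f : NCPoly R S) :
    f = ∑ w ∈ f.coeff.support, f.coeff w • MonoidAlgebra.of R (FreeMonoid S) w := by
  conv_lhs => rw [← MonoidAlgebra.sum_coeff_single f]
  simp [Finsupp.sum]

/-! ### Circuits and chains of flats -/

section MatroidFlats

variable {S : Type*} {M : Matroid S}

theorem subset_closure_of_encard_le [Finite S] {I X : Set S} (hI : M.Indep I)
    (hIX : I ⊆ M.closure X) (hcard : X.encard ≤ I.encard) (hX : X ⊆ M.E) : X ⊆ M.closure I := by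
  intro x hx
  by_contra hxI
  have hxI' : x ∉ I := fun h => hxI (M.mem_closure_of_mem h hI.subset_ground)
  have hins : M.Indep (insert x I) :=
    (hI.insert_indep_iff_of_notMem hxI').2 ⟨hX hx, hxI⟩
  have h1 : (insert x I).encard ≤ X.encard :=
    calc (insert x I).encard ≤ M.eRk (M.closure X) :=
          hins.encard_le_eRk_of_subset (Set.insert_subset (M.mem_closure_of_mem hx hX) hIX)
      _ ≤ X.encard := (M.eRk_closure_eq X).trans_le (M.eRk_le_encard X)
  rw [Set.encard_insert_of_notMem hxI'] at h1
  exact (ENat.lt_add_one_iff (Set.toFinite I).encard_lt_top.ne).2 le_rfl |>.not_ge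
    (h1.trans hcard)

/-- A circuit with more than one element has two elements that a given decreasing chain of flats does
not separate: the first flat that does not contain the circuit misses at least two of its elements. -/
theorem exists_ne_forall_mem_closure_iff {C : Set S} (hC : M.IsCircuit C) (hnt : C.Nontrivial)
    {k : ℕ} {X : Fin k → Set S} (hX : Antitone X) :
    ∃ x ∈ C, ∃ y ∈ C, x ≠ y ∧ ∀ i, x ∈ M.closure (X i) ↔ y ∈ M.closure (X i) := by
  by_cases h : ∃ i, ¬ C ⊆ M.closure (X i)
  · obtain ⟨i, hi, hmin⟩ := WellFounded.has_min (wellFounded_lt (α := Fin k))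
      {i | ¬ C ⊆ M.closure (X i)} h
    obtain ⟨x, hxC, hxi⟩ := Set.not_subset.1 hi
    have hx : ¬ C \ {x} ⊆ M.closure (X i) := fun hsub => hxi <|
      M.closure_subset_closure_of_subset_closure hsub
        (hC.mem_closure_sdiff_singleton_of_mem hxC)
    obtain ⟨y, ⟨hyC, hyx⟩, hyi⟩ := Set.not_subset.1 hx
    refine ⟨x, hxC, y, hyC, fun h => hyx h.symm, fun i' => ?_⟩
    rcases lt_or_ge i' i with hlt | hge
    · have : C ⊆ M.closure (X i') := by
        by_contra h'
        exact hmin i' h' hlt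
      exact ⟨fun _ => this hyC, fun _ => this hxC⟩
    · have hsub := M.closure_subset_closure (hX hge)
      exact ⟨fun h => absurd (hsub h) hxi, fun h => absurd (hsub h) hyi⟩
  · push Not at h
    obtain ⟨x, hx, y, hy, hxy⟩ := hnt
    exact ⟨x, hx, y, hy, hxy, fun i => ⟨fun _ => h i hy, fun _ => h i hx⟩⟩

end MatroidFlats

/-! ### Independence of the sets without broken circuits -/

section Nbc

variable {S : Type*} [LinearOrder S] {M : Matroid S}

/-- `J` does not contain a broken circuit. -/
def IsNbc (𝔐 : Set (Finset S)) (J : Finset S) : Prop :=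
  ∀ B : Finset S, IsBrokenCircuit 𝔐 B → ¬ B ⊆ J

theorem mem_removeMin {J : Finset S} {x : S} : x ∈ removeMin J ↔ x ∈ J ∧ ∃ y ∈ J, y < x :=
  Finset.mem_filter

theorem removeMin_subset (J : Finset S) : removeMin J ⊆ J := Finset.filter_subset _ _

theorem IsNbc.indep [Finite S] (hE : M.E = Set.univ) {J : Finset S} (hJ : IsNbc (circuits M) J) :
    M.Indep (J : Set S) := by
  rw [Matroid.indep_iff_forall_subset_not_isCircuit (by simp [hE])]
  intro C hCJ hC
  lift C to Finset S using Set.toFinite C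
  exact hJ _ ⟨C, hC, rfl⟩ ((removeMin_subset C).trans (Finset.coe_subset.1 hCJ))

/-- If `c` lies in the span of a subset `X` of a set without broken circuits, then `c` is not
smaller than all members of `X`: otherwise a circuit in `insert c X` through `c` would be broken
inside `X`. -/
theorem IsNbc.exists_le_of_mem_closure [Finite S] {J : Finset S} (hJ : IsNbc (circuits M) J)
    {X : Set S} (hX : X ⊆ J) {c : S} (hc : c ∈ M.closure X) : ∃ x ∈ X, x ≤ c := by
  by_contra! hlt
  obtain ⟨C, hCX, hC, -⟩ := M.exists_isCircuit_of_mem_closure hc fun h => (hlt c h).false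
  lift C to Finset S using Set.toFinite C
  refine hJ _ ⟨C, hC, rfl⟩ fun y hy => ?_
  obtain ⟨hyC, z, hzC, hzy⟩ := mem_removeMin.1 hy
  rcases hCX hyC with rfl | hyX
  · rcases hCX hzC with rfl | hzX
    · exact absurd hzy (lt_irrefl _)
    · exact absurd hzy (hlt z hzX).asymm
  · exact hX hyX

/-- The set of the elements of `J` from the `i`-th one on. -/
def upperPart (J : Finset S) {k : ℕ} (h : J.card = k) (i : Fin k) : Set S :=
  {x | x ∈ J ∧ J.orderEmbOfFin h i ≤ x}

theorem upperPart_antitone (J : Finset S) {k : ℕ} (h : J.card = k) : Antitone (upperPart J h) :=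
  fun _ _ hij _ hx => ⟨hx.1, ((J.orderEmbOfFin h).monotone hij).trans hx.2⟩

theorem upperPart_eq_image (J : Finset S) {k : ℕ} (h : J.card = k) (i : Fin k) :
    upperPart J h i = J.orderEmbOfFin h '' Set.Ici i := by
  ext x
  constructor
  · rintro ⟨hxJ, hx⟩
    obtain ⟨a, rfl⟩ : x ∈ Set.range (J.orderEmbOfFin h) := by
      rwa [Finset.range_orderEmbOfFin, Finset.mem_coe]
    exact ⟨a, (J.orderEmbOfFin h).le_iff_le.1 hx, rfl⟩
  · rintro ⟨a, ha, rfl⟩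
    exact ⟨J.orderEmbOfFin_mem h a, (J.orderEmbOfFin h).monotone ha⟩

theorem word_eq_ofFn (J : Finset S) {k : ℕ} (h : J.card = k) :
    word J = FreeMonoid.ofList (List.ofFn (J.orderEmbOfFin h)) := by
  rw [word, ← Finset.listMap_orderEmbOfFin_finRange J h, List.ofFn_eq_map]

open scoped Classical in
/-- The vectors attached to the chain of flats spanned by the upper parts of `J`. The second
component of `flagVector M J h s` records which flats contain `s`, and the first one is `1`. -/
noncomputable def flagVector (R : Type*) [CommRing R] (M : Matroid S) (J : Finset S) {k : ℕ}
    (h : J.card = k) (s : S) : R × (Fin k → R) :=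
  (1, fun i => if s ∈ M.closure (upperPart J h i) then 1 else 0)

/-- The determinant of the second components. -/
noncomputable def sndDet (R : Type*) [CommRing R] (k : ℕ) :
    (R × (Fin k → R)) [⋀^Fin k]→ₗ[R] R :=
  Matrix.detRowAlternating.compLinearMap (LinearMap.snd R R (Fin k → R))

theorem sndDet_apply {R : Type*} [CommRing R] {k : ℕ} (v : Fin k → R × (Fin k → R)) :
    sndDet R k v = Matrix.det (Matrix.of fun a => (v a).2) := rfl

/-- As `J` is independent, its matrix of incidences with the chain of flats is unitriangular. -/
theorem sndDet_flagVector_self (R : Type*) [CommRing R] {J : Finset S} (hJ : M.Indep (J : Set S))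
    {k : ℕ} (h : J.card = k) :
    sndDet R k (fun a => flagVector R M J h (J.orderEmbOfFin h a)) = 1 := by
  rw [sndDet_apply, Matrix.det_of_isLowerTriangular]
  · refine Finset.prod_eq_one fun i _ => ?_
    have hmem : J.orderEmbOfFin h i ∈ M.closure (upperPart J h i) :=
      M.subset_closure _ (fun x hx => hJ.subset_ground hx.1) ⟨J.orderEmbOfFin_mem h i, le_rfl⟩
    exact if_pos hmem
  · intro a i hai
    refine if_neg fun hmem => ?_
    have hsub : upperPart J h i ⊆ (J : Set S) \ {J.orderEmbOfFin h a} := by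
      refine fun x hx => ⟨hx.1, ?_⟩
      rintro rfl
      exact absurd ((J.orderEmbOfFin h).le_iff_le.1 hx.2) (not_le.2 hai)
    exact hJ.notMem_closure_sdiff_of_mem (J.orderEmbOfFin_mem h a)
      (M.closure_subset_closure hsub hmem)

/-- The determinant attached to `J` vanishes on all other sets without broken circuits of the same
cardinality. -/
theorem sndDet_flagVector_eq_zero [Finite S] (R : Type*) [CommRing R] (hE : M.E = Set.univ)
    {J K : Finset S} (hJ : IsNbc (circuits M) J) (hK : IsNbc (circuits M) K) {k : ℕ}
    (h : J.card = k) (h' : K.card = k) (hne : K ≠ J) :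
    sndDet R k (fun a => flagVector R M J h (K.orderEmbOfFin h' a)) = 0 := by
  by_contra hdet
  rw [sndDet_apply, Matrix.det_apply] at hdet
  obtain ⟨σ, -, hσ⟩ := Finset.exists_ne_zero_of_sum_ne_zero hdet
  have hmem : ∀ i, K.orderEmbOfFin h' (σ i) ∈ M.closure (upperPart J h i) := by
    intro i
    by_contra hi
    refine hσ ?_
    rw [Finset.prod_eq_zero (Finset.mem_univ i) (if_neg hi), smul_zero]
  refine hne (Finset.eq_of_subset_of_card_le (fun x hx => ?_) (h'.trans h.symm).le).symm
  obtain ⟨i, rfl⟩ : x ∈ Set.range (J.orderEmbOfFin h) := by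
    rwa [Finset.range_orderEmbOfFin, Finset.mem_coe]
  -- The part of `K` in the `i`-th flat spans this flat, for it has enough elements.
  set I : Set S := (K.orderEmbOfFin h' ∘ σ) '' Set.Ici i with hI
  have hIK : I ⊆ K := by
    rintro _ ⟨a, -, rfl⟩
    exact K.orderEmbOfFin_mem h' _
  have hIX : I ⊆ M.closure (upperPart J h i) := by
    rintro _ ⟨a, ha, rfl⟩
    exact M.closure_subset_closure (upperPart_antitone J h ha) (hmem a)
  have hcard : (upperPart J h i).encard ≤ I.encard := by
    rw [upperPart_eq_image, (J.orderEmbOfFin h).injective.encard_image, hI,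
      ((K.orderEmbOfFin h').injective.comp σ.injective).encard_image]
  have hspan := subset_closure_of_encard_le ((hK.indep hE).subset hIK) hIX hcard (by simp [hE])
  -- Both `J` and `K` contain the least element of the flat.
  obtain ⟨y, hyI, hy⟩ := hK.exists_le_of_mem_closure hIK
    (hspan ⟨J.orderEmbOfFin_mem h i, le_rfl⟩)
  obtain ⟨z, hz, hzy⟩ := hJ.exists_le_of_mem_closure (fun z hz => hz.1) (hIX hyI)
  rw [le_antisymm (hz.2.trans hzy) hy]
  exact hIK hyI

/-- The ideal acts as zero in the representation attached to the chain of flats of `J`. -/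
theorem cliffordAction_flagVector_eq_zero [M.Loopless] {R : Type*} [CommRing R] (q : R)
    (J : Finset S) {k : ℕ} (h : J.card = k) {f : NCPoly R S} (hf : f ∈ idealQ q (circuits M)) :
    cliffordAction (LinearMap.fst R R (Fin k → R)) q (flagVector R M J h) f = 0 := by
  set φ := cliffordAction (LinearMap.fst R R (Fin k → R)) q (flagVector R M J h) with hφ
  have hd : ∀ s, LinearMap.fst R R (Fin k → R) (flagVector R M J h s) = 1 := fun s => rfl
  have hle : idealQ q (circuits M) ≤ TwoSidedIdeal.ker φ := by
    refine TwoSidedIdeal.span_le.2 ?_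
    rintro g ((⟨s, rfl⟩ | ⟨r, s, -, rfl⟩) | ⟨C, hC, rfl⟩) <;>
      rw [SetLike.mem_coe, TwoSidedIdeal.mem_ker]
    · rw [map_sub, map_pow, AlgHom.commutes, hφ, cliffordAction_t, pow_two,
        cliffordOp_mul_self q (hd s), sub_self]
    · rw [map_sub, map_add, map_mul, map_mul, AlgHom.commutes, hφ, cliffordAction_t,
        cliffordAction_t, cliffordOp_mul_add_mul q (hd r) (hd s), sub_self]
    · have hnt := Matroid.loopless_iff_forall_isCircuit.1 ‹M.Loopless› _ hC
      obtain ⟨x, hx, y, hy, hxy, hiff⟩ :=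
        exists_ne_forall_mem_closure_iff hC hnt (upperPart_antitone J h)
      refine cliffordAction_tm_eq_zero q hd hx hy hxy ?_
      classical exact congrArg (Prod.mk 1) (funext fun i => if_congr (hiff i) rfl rfl)
  exact (TwoSidedIdeal.mem_ker _).1 (hle hf)

/-- The monomials of the sets without broken circuits are linearly independent modulo the ideal. -/
theorem eq_zero_of_mem_idealQ [Finite S] [M.Loopless] (hE : M.E = Set.univ) {R : Type*}
    [CommRing R] (q : R) {f : NCPoly R S} (hf : f ∈ idealQ q (circuits M))
    (hsupp : ∀ w, f.coeff w ≠ 0 → ∃ J, w = word J ∧ IsNbc (circuits M) J) : f = 0 := by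
  by_contra hne
  have hnonempty : f.coeff.support.Nonempty :=
    Finsupp.support_nonempty_iff.2 fun h => hne (MonoidAlgebra.coeff_eq_zero.1 h)
  -- Choose a monomial of maximal degree in `f`.
  obtain ⟨w, hw, hmax⟩ := f.coeff.support.exists_max_image FreeMonoid.length hnonempty
  rw [Finsupp.mem_support_iff] at hw
  obtain ⟨J, rfl, hJ⟩ := hsupp w hw
  obtain ⟨k, h⟩ : ∃ k, J.card = k := ⟨_, rfl⟩
  set φ := cliffordAction (LinearMap.fst R R (Fin k → R)) q (flagVector R M J h)
  have hlen : ∀ K : Finset S, (word K).length = K.card := fun K => K.length_sort (· ≤ ·)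
  have hword : ∀ K, IsNbc (circuits M) K → K.card ≤ k → K ≠ J →
      topForm (sndDet R k) (φ (MonoidAlgebra.of R _ (word K)) 1) = 0 := by
    intro K hK hle hKJ
    rcases hle.lt_or_eq with hlt | heq
    · exact topForm_cliffordAction_of_length_lt _ _ _ _ (by rwa [Finset.length_sort])
    · rw [word_eq_ofFn K heq, topForm_cliffordAction_ofFn]
      exact sndDet_flagVector_eq_zero R hE hJ hK h heq hKJ
  have hself : topForm (sndDet R k) (φ (MonoidAlgebra.of R _ (word J)) 1) = 1 := by
    rw [word_eq_ofFn J h, topForm_cliffordAction_ofFn]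
    exact sndDet_flagVector_self R (hJ.indep hE) h
  have hsum : topForm (sndDet R k) (φ f 1) = f.coeff (word J) := by
    conv_lhs => rw [eq_sum_smul_of f]
    rw [map_sum, LinearMap.sum_apply, map_sum, Finset.sum_eq_single (word J)]
    · rw [map_smul, LinearMap.smul_apply, map_smul, hself, smul_eq_mul, mul_one]
    · intro v hv hvJ
      obtain ⟨K, rfl, hK⟩ := hsupp v (Finsupp.mem_support_iff.1 hv)
      have := hmax _ hv
      rw [hlen, hlen, h] at this
      rw [map_smul, LinearMap.smul_apply, map_smul,
        hword K hK this fun h => hvJ (by rw [h]), smul_zero]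
    · intro hJ'
      exact absurd (Finsupp.mem_support_iff.2 hw) hJ'
  rw [cliffordAction_flagVector_eq_zero q J h hf, LinearMap.zero_apply, map_zero] at hsum
  exact hw hsum.symm

end Nbc

/-! ### Coefficients and quotients of the free algebra -/

section FreeAlgebra

variable {R : Type*} [CommRing R] {S : Type*}

theorem mem_of_coeff_ne_zero {T : Set (FreeMonoid S)} {f : NCPoly R S}
    (hf : f ∈ Submodule.span R (MonoidAlgebra.of R (FreeMonoid S) '' T)) {w : FreeMonoid S}
    (hw : f.coeff w ≠ 0) : w ∈ T := by
  classical
  contrapose! hw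
  induction hf using Submodule.span_induction with
  | mem x hx =>
    obtain ⟨v, hv, rfl⟩ := hx
    rw [MonoidAlgebra.of_apply, MonoidAlgebra.coeff_single, Finsupp.single_apply, if_neg]
    rintro rfl
    exact hw hv
  | zero => rfl
  | add x y _ _ hx hy => rw [MonoidAlgebra.coeff_add, Finsupp.add_apply, hx, hy, add_zero]
  | smul c x _ hx => rw [MonoidAlgebra.coeff_smul, Finsupp.smul_apply, hx, smul_zero]

theorem mkₐ_eq_zero_iff {I : TwoSidedIdeal (NCPoly R S)} {f : NCPoly R S} :
    I.ringCon.mkₐ R f = 0 ↔ f ∈ I := by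
  rw [TwoSidedIdeal.mem_iff, ← RingCon.eq]
  rfl

end FreeAlgebra

/-! ### Reduction modulo a two-sided ideal -/

section Groebner

variable {R : Type*} [CommRing R] {S : Type*} [LinearOrder S]

theorem degLex_wf [Finite S] : WellFounded (DegLex (S := S)) :=
  InvImage.wf FreeMonoid.toList (List.Shortlex.wf (wellFounded_lt (α := S)))

theorem DegLex.asymm {v w : FreeMonoid S} (h : DegLex v w) : ¬ DegLex w v :=
  fun h' => Std.Asymm.asymm (r := List.Shortlex (· < · : S → S → Prop)) _ _ h h'

theorem DegLex.trans {u v w : FreeMonoid S} (h : DegLex u v) (h' : DegLex v w) : DegLex u w := by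
  rw [DegLex, List.shortlex_def] at h h' ⊢
  rcases h with h | ⟨h, hl⟩ <;> rcases h' with h' | ⟨h', hl'⟩
  · exact Or.inl (h.trans h')
  · exact Or.inl (h'.symm ▸ h)
  · exact Or.inl (h ▸ h')
  · exact Or.inr ⟨h.trans h', List.lt_trans hl hl'⟩

theorem lex_append_right_of_length_eq {s t : List S} (h : List.Lex (· < ·) s t)
    (hlen : s.length = t.length) (b : List S) : List.Lex (· < ·) (s ++ b) (t ++ b) := by
  induction h with
  | nil => simp at hlen
  | rel h => exact List.Lex.rel h
  | cons _ ih => exact List.Lex.cons (ih (by simpa using hlen))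

theorem DegLex.mul_mul {v w : FreeMonoid S} (h : DegLex v w) (a b : FreeMonoid S) :
    DegLex (a * v * b) (a * w * b) := by
  rw [mul_assoc, mul_assoc]
  refine List.Shortlex.append_left ?_ (FreeMonoid.toList a)
  rw [DegLex, List.shortlex_def] at h
  rw [FreeMonoid.toList_mul, FreeMonoid.toList_mul, List.shortlex_def, List.length_append,
    List.length_append]
  rcases h with h | ⟨h, hl⟩
  · exact Or.inl (by omega)
  · exact Or.inr ⟨by omega, lex_append_right_of_length_eq hl h _⟩

theorem IsLeadingMonomial.unique {f : NCPoly R S} {v w : FreeMonoid S}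
    (hv : IsLeadingMonomial f v) (hw : IsLeadingMonomial f w) : v = w := by
  by_contra h
  exact (hw.2 v hv.1 h).asymm (hv.2 w hw.1 fun h' => h h'.symm)

/-- The span of the words smaller than `w`. -/
noncomputable def lowerSpan (R : Type*) [CommRing R] (w : FreeMonoid S) :
    Submodule R (NCPoly R S) :=
  Submodule.span R (MonoidAlgebra.of R (FreeMonoid S) '' {v | DegLex v w})

theorem of_mem_lowerSpan {v w : FreeMonoid S} (h : DegLex v w) :
    MonoidAlgebra.of R _ v ∈ lowerSpan R w :=
  Submodule.subset_span ⟨v, h, rfl⟩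

theorem coeff_of_add_self {w : FreeMonoid S} {h : NCPoly R S} (hh : h ∈ lowerSpan R w) :
    (MonoidAlgebra.of R _ w + h).coeff w = 1 := by
  have h0 : h.coeff w = 0 := by
    by_contra h0
    have : DegLex w w := mem_of_coeff_ne_zero hh h0
    exact this.asymm this
  rw [MonoidAlgebra.coeff_add, Finsupp.add_apply, h0, add_zero, MonoidAlgebra.of_apply,
    MonoidAlgebra.coeff_single, Finsupp.single_eq_same]

theorem isLeadingMonomial_of_add [Nontrivial R] {w : FreeMonoid S} {h : NCPoly R S}
    (hh : h ∈ lowerSpan R w) : IsLeadingMonomial (MonoidAlgebra.of R _ w + h) w := by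
  refine ⟨by rw [coeff_of_add_self hh]; exact one_ne_zero, fun v hv hvw => ?_⟩
  refine mem_of_coeff_ne_zero hh fun h0 => hv ?_
  rw [MonoidAlgebra.coeff_add, Finsupp.add_apply, h0, add_zero, MonoidAlgebra.of_apply,
    MonoidAlgebra.coeff_single, Finsupp.single_eq_of_ne hvw]

variable {I : TwoSidedIdeal (NCPoly R S)} {G : Set (NCPoly R S)}

/-- Reduction: modulo `I`, every word is a linear combination of standard words that do not exceed
it. -/
theorem mkₐ_of_mem_span_standardMonomials [Finite S] (hGI : G ⊆ {f | f ∈ I})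
    (hG : ∀ g ∈ G, ∀ m, IsLeadingMonomial g m → IsUnit (g.coeff m)) (w : FreeMonoid S) :
    I.ringCon.mkₐ R (MonoidAlgebra.of R _ w) ∈
      Submodule.span R ((fun v => I.ringCon.mkₐ R (MonoidAlgebra.of R _ v)) ''
        {v | v ∈ standardMonomials G ∧ (v = w ∨ DegLex v w)}) := by
  classical
  induction w using (degLex_wf (S := S)).induction with
  | _ w ih =>
  by_cases hw : w ∈ standardMonomials G
  · exact Submodule.subset_span ⟨w, ⟨hw, Or.inl rfl⟩, rfl⟩
  simp only [standardMonomials, Set.mem_ofPred_eq, not_forall, not_not] at hw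
  obtain ⟨g, hg, m, hm, a, b, rfl⟩ := hw
  set π := I.ringCon.mkₐ R
  have hzero : π (MonoidAlgebra.of R _ a * g * MonoidAlgebra.of R _ b) = 0 :=
    mkₐ_eq_zero_iff.2 (I.mul_mem_right _ _ (I.mul_mem_left _ _ (hGI hg)))
  have hexp : MonoidAlgebra.of R _ a * g * MonoidAlgebra.of R _ b =
      ∑ v ∈ g.coeff.support, g.coeff v • MonoidAlgebra.of R _ (a * v * b) := by
    conv_lhs => rw [eq_sum_smul_of g]
    rw [Finset.mul_sum, Finset.sum_mul]
    refine Finset.sum_congr rfl fun v _ => ?_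
    rw [mul_smul_comm, smul_mul_assoc, map_mul, map_mul]
  rw [hexp, map_sum, ← Finset.add_sum_erase _ _ (Finsupp.mem_support_iff.2 hm.1), map_smul] at hzero
  refine (Submodule.smul_mem_iff_of_isUnit _ (hG g hg m hm)).1 ?_
  rw [eq_neg_of_add_eq_zero_left hzero]
  refine neg_mem (sum_mem fun v hv => ?_)
  obtain ⟨hvm, hv⟩ := Finset.mem_erase.1 hv
  have hlt := (hm.2 v (Finsupp.mem_support_iff.1 hv) hvm).mul_mul a b
  rw [map_smul]
  refine Submodule.smul_mem _ _ (Submodule.span_mono (Set.image_mono ?_) (ih _ hlt))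
  rintro u ⟨hu, rfl | hlt'⟩
  · exact ⟨hu, Or.inr hlt⟩
  · exact ⟨hu, Or.inr (hlt'.trans hlt)⟩

/-- If no non-trivial combination of standard words lies in `I`, then the leading monomial of an
element of `I` is not standard. -/
theorem IsLeadingMonomial.notMem_standardMonomials [Finite S] (hGI : G ⊆ {f | f ∈ I})
    (hG : ∀ g ∈ G, ∀ m, IsLeadingMonomial g m → IsUnit (g.coeff m))
    (hind : ∀ f ∈ I, (∀ w, f.coeff w ≠ 0 → w ∈ standardMonomials G) → f = 0)
    {f : NCPoly R S} (hf : f ∈ I) {w : FreeMonoid S} (hw : IsLeadingMonomial f w) :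
    w ∉ standardMonomials G := by
  classical
  intro hstd
  set π := I.ringCon.mkₐ R
  set T : Set (FreeMonoid S) := {v | v ∈ standardMonomials G ∧ DegLex v w} with hT
  have hrest : π (∑ v ∈ f.coeff.support.erase w, f.coeff v • MonoidAlgebra.of R _ v) ∈
      (Submodule.span R (MonoidAlgebra.of R (FreeMonoid S) '' T)).map π.toLinearMap := by
    rw [Submodule.map_span, ← Set.image_comp, map_sum]
    refine sum_mem fun v hv => ?_
    obtain ⟨hvw, hv⟩ := Finset.mem_erase.1 hv
    have hlt := hw.2 v (Finsupp.mem_support_iff.1 hv) hvw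
    rw [map_smul]
    refine Submodule.smul_mem _ _ (Submodule.span_mono (Set.image_mono ?_)
      (mkₐ_of_mem_span_standardMonomials hGI hG v))
    rintro u ⟨hu, rfl | hlt'⟩
    · exact ⟨hu, hlt⟩
    · exact ⟨hu, hlt'.trans hlt⟩
  obtain ⟨h, hh, hπ⟩ := hrest
  have hcoeff : ∀ v, h.coeff v ≠ 0 → v ∈ T := fun v hv => mem_of_coeff_ne_zero hh hv
  have hsingle : ∀ v, (f.coeff w • MonoidAlgebra.of R (FreeMonoid S) w + h).coeff v =
      (if w = v then f.coeff w else 0) + h.coeff v := by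
    intro v
    rw [MonoidAlgebra.coeff_add, Finsupp.add_apply, MonoidAlgebra.coeff_smul, Finsupp.smul_apply,
      MonoidAlgebra.of_apply, MonoidAlgebra.coeff_single, Finsupp.single_apply, smul_eq_mul,
      mul_ite, mul_one, mul_zero]
  have hmem : f.coeff w • MonoidAlgebra.of R (FreeMonoid S) w + h ∈ I := by
    rw [← mkₐ_eq_zero_iff, map_add]
    have hπ' : π h = π (∑ v ∈ f.coeff.support.erase w, f.coeff v • MonoidAlgebra.of R _ v) := hπ
    rw [hπ', ← map_add, Finset.add_sum_erase _
        (fun v => f.coeff v • MonoidAlgebra.of R (FreeMonoid S) v) (Finsupp.mem_support_iff.2 hw.1),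
      ← eq_sum_smul_of f, mkₐ_eq_zero_iff]
    exact hf
  have hzero := hind _ hmem fun v hv => by
    rw [hsingle] at hv
    by_cases hvw : w = v
    · exact hvw ▸ hstd
    · rw [if_neg hvw, zero_add] at hv
      exact (hcoeff v hv).1
  have hcw : h.coeff w = 0 := by
    by_contra h0
    exact (hcoeff w h0).2.asymm (hcoeff w h0).2
  refine hw.1 ?_
  have := hsingle w
  rw [hzero, if_pos rfl, hcw, add_zero] at this
  exact this.symm

theorem isGroebnerBasis_of_independent [Finite S] (hGI : G ⊆ {f | f ∈ I})
    (hG : ∀ g ∈ G, ∀ m, IsLeadingMonomial g m → IsUnit (g.coeff m))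
    (hind : ∀ f ∈ I, (∀ w, f.coeff w ≠ 0 → w ∈ standardMonomials G) → f = 0) :
    IsGroebnerBasis G I := by
  refine ⟨hGI, le_antisymm (TwoSidedIdeal.span_mono ?_) (TwoSidedIdeal.span_le.2 ?_)⟩
  · rintro _ ⟨f, hf, w, hw, rfl⟩
    exact ⟨f, hGI hf, w, hw, rfl⟩
  · rintro _ ⟨f, hf, w, hw, rfl⟩
    have hstd := hw.notMem_standardMonomials hGI hG hind hf
    simp only [standardMonomials, Set.mem_ofPred_eq, not_forall, not_not] at hstd
    obtain ⟨g, hg, m, hm, a, b, hwab⟩ := hstd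
    obtain ⟨u, hu⟩ := hG g hg m hm
    have h1 : MonoidAlgebra.single m (g.coeff m) ∈ TwoSidedIdeal.span (leadingTerms G) :=
      TwoSidedIdeal.subset_span ⟨g, hg, m, hm, rfl⟩
    have h2 : MonoidAlgebra.single w (f.coeff w) =
        MonoidAlgebra.single a (f.coeff w * ↑u⁻¹) * MonoidAlgebra.single m (g.coeff m) *
          MonoidAlgebra.single b 1 := by
      rw [MonoidAlgebra.single_mul_single, MonoidAlgebra.single_mul_single, ← hwab, ← hu, mul_one,
        mul_assoc, Units.inv_mul, mul_one]
    rw [SetLike.mem_coe, h2]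
    exact TwoSidedIdeal.mul_mem_right _ _ _ (TwoSidedIdeal.mul_mem_left _ _ _ h1)

/-- The standard words form a basis of the quotient by `I`. -/
theorem nonempty_basis_standardMonomials [Finite S] (hGI : G ⊆ {f | f ∈ I})
    (hG : ∀ g ∈ G, ∀ m, IsLeadingMonomial g m → IsUnit (g.coeff m))
    (hind : ∀ f ∈ I, (∀ w, f.coeff w ≠ 0 → w ∈ standardMonomials G) → f = 0) :
    Nonempty (Module.Basis (standardMonomials G) R I.ringCon.Quotient) := by
  set π := I.ringCon.mkₐ R
  have hli : LinearIndepOn R (fun w => π (MonoidAlgebra.of R _ w)) (standardMonomials G) := by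
    refine linearIndepOn_iff.2 fun l hl h0 => ?_
    have hmem : MonoidAlgebra.ofCoeff l ∈ I := by
      rw [← mkₐ_eq_zero_iff, eq_sum_smul_of (MonoidAlgebra.ofCoeff l), map_sum, ← h0,
        Finsupp.linearCombination_apply, Finsupp.sum]
      exact Finset.sum_congr rfl fun v _ => map_smul _ _ _
    exact MonoidAlgebra.ofCoeff_eq_zero.1 (hind _ hmem fun w hw =>
      hl (Finset.mem_coe.2 (Finsupp.mem_support_iff.2 hw)))
  refine ⟨Module.Basis.mk hli fun x _ => ?_⟩
  obtain ⟨f, rfl⟩ := RingCon.mkₐ_surjective (α := R) I.ringCon x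
  rw [eq_sum_smul_of f, map_sum]
  refine sum_mem fun v _ => ?_
  rw [map_smul]
  refine Submodule.smul_mem _ _ (Submodule.span_mono ?_
    (mkₐ_of_mem_span_standardMonomials hGI hG v))
  rintro _ ⟨u, hu, rfl⟩
  exact ⟨⟨u, hu.1⟩, rfl⟩

end Groebner

/-! ### Words of subsets -/

section Words

variable {S : Type*} [LinearOrder S]

theorem toList_word (J : Finset S) : FreeMonoid.toList (word J) = J.sort (· ≤ ·) := rfl

theorem mem_toList_word {J : Finset S} {x : S} : x ∈ FreeMonoid.toList (word J) ↔ x ∈ J :=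
  Finset.mem_sort (· ≤ ·)

theorem exists_eq_word_of_pairwise_lt {w : FreeMonoid S}
    (hw : (FreeMonoid.toList w).Pairwise (· < ·)) : ∃ J, w = word J := by
  refine ⟨(FreeMonoid.toList w).toFinset, FreeMonoid.toList.injective ?_⟩
  rw [toList_word]
  exact ((List.toFinset_sort (· ≤ ·) (hw.imp ne_of_lt)).2 (hw.imp le_of_lt)).symm

theorem word_empty : word (∅ : Finset S) = 1 := by
  rw [word, Finset.sort_empty, FreeMonoid.ofList_nil]

theorem word_union {A B : Finset S} (h : ∀ a ∈ A, ∀ b ∈ B, a < b) :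
    word (A ∪ B) = word A * word B := by
  induction A using Finset.induction_on_min with
  | empty => rw [Finset.empty_union, word_empty, one_mul]
  | insert x A hx ih =>
    rw [Finset.insert_union, word_insert, word_insert hx, mul_assoc,
      ih fun a ha => h a (Finset.mem_insert_of_mem ha)]
    intro y hy
    rcases Finset.mem_union.1 hy with hy | hy
    · exact hx y hy
    · exact h x (Finset.mem_insert_self x A) y hy

/-- The word of a convex subset is a factor. -/
theorem IsConvexSubset.exists_word_eq_mul {K J : Finset S} (h : IsConvexSubset K J) :
    ∃ a b, word J = a * word K * b := by
  classical
  set A := J.filter fun j => ∀ k ∈ K, j < k with hA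
  set B := J.filter fun j => (∀ k ∈ K, k < j) ∧ ¬ ∀ k ∈ K, j < k with hB
  have hJ : J = A ∪ K ∪ B := by
    ext j
    simp only [hA, hB, Finset.mem_union, Finset.mem_filter]
    constructor
    · intro hj
      by_cases hjK : j ∈ K
      · exact Or.inl (Or.inr hjK)
      by_cases hjA : ∀ k ∈ K, j < k
      · exact Or.inl (Or.inl ⟨hj, hjA⟩)
      refine Or.inr ⟨hj, fun k' hk' => ?_, hjA⟩
      push Not at hjA
      obtain ⟨k, hk, hkj⟩ := hjA
      by_contra hjk'
      exact hjK (h.2 j hj k hk k' hk' (lt_of_le_of_ne hkj fun e => hjK (e ▸ hk))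
        (lt_of_le_of_ne (not_lt.1 hjk') fun e => hjK (e ▸ hk')))
    · rintro ((hj | hj) | hj)
      · exact hj.1
      · exact h.1 hj
      · exact hj.1
  refine ⟨word A, word B, ?_⟩
  have hAK : ∀ a ∈ A, ∀ k ∈ K, a < k := fun a ha => (Finset.mem_filter.1 ha).2
  rw [← word_union hAK, ← word_union, ← hJ]
  intro a ha b hb
  obtain ⟨-, hb1, hb2⟩ := Finset.mem_filter.1 hb
  rcases Finset.mem_union.1 ha with ha | ha
  · push Not at hb2
    obtain ⟨k, hk, hkb⟩ := hb2
    exact (hAK a ha k hk).trans_le hkb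
  · exact hb1 a ha

theorem IsConvexSubset.trans {K J L : Finset S} (h : IsConvexSubset K J)
    (h' : IsConvexSubset J L) : IsConvexSubset K L :=
  ⟨h.1.trans h'.1, fun l hl k hk k' hk' hkl hlk' =>
    h.2 l (h'.2 l hl k (h.1 hk) k' (h.1 hk') hkl hlk') k hk k' hk' hkl hlk'⟩

theorem removeMin_insert {x : S} {J : Finset S} (hx : ∀ y ∈ J, x < y) :
    removeMin (insert x J) = J := by
  ext y
  rw [mem_removeMin]
  constructor
  · rintro ⟨hy, z, hz, hzy⟩
    rcases Finset.mem_insert.1 hy with rfl | hy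
    · rcases Finset.mem_insert.1 hz with rfl | hz
      · exact absurd hzy (lt_irrefl _)
      · exact absurd hzy (hx z hz).asymm
    · exact hy
  · exact fun hy => ⟨Finset.mem_insert_of_mem hy, x, Finset.mem_insert_self _ _, hx y hy⟩

theorem exists_eq_insert_of_nonempty {J : Finset S} (hJ : J.Nonempty) :
    ∃ x, J = insert x (removeMin J) ∧ ∀ y ∈ removeMin J, x < y := by
  have hlt : ∀ y ∈ removeMin J, J.min' hJ < y := fun y hy => by
    obtain ⟨-, z, hz, hzy⟩ := mem_removeMin.1 hy
    exact (J.min'_le z hz).trans_lt hzy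
  refine ⟨J.min' hJ, ?_, hlt⟩
  ext y
  rw [Finset.mem_insert, mem_removeMin]
  constructor
  · intro hy
    rcases (J.min'_le y hy).eq_or_lt with h | h
    · exact Or.inl h.symm
    · exact Or.inr ⟨hy, _, J.min'_mem hJ, h⟩
  · rintro (rfl | h)
    · exact J.min'_mem hJ
    · exact h.1

end Words

/-! ### Gröbner circuits and broken circuits -/

section GroebnerCircuits

theorem Dependent.nonempty {S : Type*} {𝔐 : Set (Finset S)} (hne : ∀ C ∈ 𝔐, C.Nonempty)
    {J : Finset S} (hJ : Dependent 𝔐 J) :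
    J.Nonempty :=
  let ⟨C, hC, hCJ⟩ := hJ
  (hne C hC).mono hCJ

variable {S : Type*} [LinearOrder S] {𝔐 : Set (Finset S)}

/-- A set whose truncation contains the truncation of a dependent set is not nbc. -/
theorem IsNbc.not_removeMin_subset {J K : Finset S} (hJ : IsNbc 𝔐 J) (hK : Dependent 𝔐 K) :
    ¬ removeMin K ⊆ J := by
  obtain ⟨C, hC, hCK⟩ := hK
  refine fun hsub => hJ _ ⟨C, hC, rfl⟩ fun x hx => hsub ?_
  obtain ⟨hxC, y, hyC, hyx⟩ := mem_removeMin.1 hx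
  exact mem_removeMin.2 ⟨hCK hxC, y, hCK hyC, hyx⟩

/-- Every broken circuit in `J` gives a Gröbner circuit whose truncation is convex in `J`: take the
final segment of `J` above the least element of the circuit, together with this element, and use
the recursive definition of Gröbner circuits. -/
theorem exists_isGroebnerCircuit_of_not_isNbc [Finite S] (hne : ∀ C ∈ 𝔐, C.Nonempty)
    {J : Finset S} (hJ : ¬ IsNbc 𝔐 J) :
    ∃ K, IsGroebnerCircuit 𝔐 K ∧ IsConvexSubset (removeMin K) J := by
  simp only [IsNbc, not_forall, not_not] at hJ
  obtain ⟨_, ⟨C, hC, rfl⟩, hCJ⟩ := hJ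
  obtain ⟨c, hCc, hc⟩ := exists_eq_insert_of_nonempty (hne C hC)
  set J' := J.filter (c < ·) with hJ'
  have hlt : ∀ y ∈ J', c < y := fun y hy => (Finset.mem_filter.1 hy).2
  have hconv : IsConvexSubset J' J := ⟨Finset.filter_subset _ _, fun j hj k hk _ _ hkj _ =>
    Finset.mem_filter.2 ⟨hj, (hlt k hk).trans hkj⟩⟩
  have hdep : Dependent 𝔐 (insert c J') := by
    refine ⟨C, hC, ?_⟩
    rw [hCc]
    exact Finset.insert_subset_insert c fun x hx => Finset.mem_filter.2 ⟨hCJ hx, hc x hx⟩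
  by_cases hG : IsGroebnerCircuit 𝔐 (insert c J')
  · exact ⟨_, hG, by rwa [removeMin_insert hlt]⟩
  · rw [isGroebnerCircuit_iff] at hG
    simp only [hdep, true_and, not_forall, not_not] at hG
    obtain ⟨K, hK, -, hKJ⟩ := hG
    rw [removeMin_insert hlt] at hKJ
    exact ⟨K, hK, hKJ.trans hconv⟩

theorem dependent_of_mem_groebnerCircuits [Finite S] {J : Finset S} (hJ : J ∈ groebnerCircuits 𝔐) :
    Dependent 𝔐 J :=
  ((isGroebnerCircuit_iff 𝔐 J).1 hJ).1

end GroebnerCircuits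

/-! ### Leading monomials of the generators -/

section Generators

variable {R : Type*} [CommRing R] {S : Type*} [LinearOrder S]

theorem degLex_of_length_lt {v w : FreeMonoid S}
    (h : (FreeMonoid.toList v).length < (FreeMonoid.toList w).length) : DegLex v w :=
  List.Shortlex.of_length_lt h

theorem algebraMap_mem_lowerSpan (c : R) {w : FreeMonoid S} (hw : FreeMonoid.toList w ≠ []) :
    algebraMap R (NCPoly R S) c ∈ lowerSpan R w := by
  rw [Algebra.algebraMap_eq_smul_one, ← map_one (MonoidAlgebra.of R (FreeMonoid S))]
  exact Submodule.smul_mem _ _ (of_mem_lowerSpan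
    (degLex_of_length_lt (by simpa using List.length_pos_iff.2 hw)))

theorem t_sq_sub_eq (q : R) (s : S) : ∃ h ∈ lowerSpan R (FreeMonoid.of s * FreeMonoid.of s),
    t R s ^ 2 - algebraMap R (NCPoly R S) q =
      MonoidAlgebra.of R _ (FreeMonoid.of s * FreeMonoid.of s) + h :=
  ⟨_, neg_mem (algebraMap_mem_lowerSpan q (by simp)), by
    rw [map_mul, ← sub_eq_add_neg, pow_two]; rfl⟩

theorem t_mul_add_mul_sub_eq (q : R) {r s : S} (hsr : s < r) :
    ∃ h ∈ lowerSpan R (FreeMonoid.of r * FreeMonoid.of s),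
      t R r * t R s + t R s * t R r - algebraMap R (NCPoly R S) (2 * q) =
        MonoidAlgebra.of R _ (FreeMonoid.of r * FreeMonoid.of s) + h := by
  refine ⟨MonoidAlgebra.of R _ (FreeMonoid.of s * FreeMonoid.of r) - algebraMap R _ (2 * q),
    sub_mem (of_mem_lowerSpan ?_) (algebraMap_mem_lowerSpan _ (by simp)), ?_⟩
  · exact List.Shortlex.of_lex rfl (List.Lex.rel hsr)
  · rw [(MonoidAlgebra.of R _).map_mul, (MonoidAlgebra.of R _).map_mul, add_sub_assoc]
    rfl

theorem length_toList_word (J : Finset S) : (FreeMonoid.toList (word J)).length = J.card :=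
  Finset.length_sort (· ≤ ·)

theorem of_mul_word_degLex {x : S} {J K : Finset S} (hx : ∀ y ∈ J, x < y)
    (hcard : K.card + 1 ≤ J.card) : DegLex (FreeMonoid.of x * word K) (word J) := by
  have hlen : (FreeMonoid.toList (FreeMonoid.of x * word K)).length = K.card + 1 := by
    rw [← length_toList_word]
    rfl
  rcases hcard.lt_or_eq with h | h
  · exact degLex_of_length_lt (by rwa [hlen, length_toList_word])
  · refine List.Shortlex.of_lex (by rw [hlen, h, length_toList_word]) ?_
    rcases hJ : FreeMonoid.toList (word J) with _ | ⟨y, l⟩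
    · have := length_toList_word J
      rw [hJ, List.length_nil] at this
      omega
    · exact List.Lex.rel (hx y (mem_toList_word.1 (by rw [hJ]; exact List.mem_cons_self)))

/-- The leading term of `tm q J` is the one of `I = {min J}`. -/
theorem tm_eq (q : R) {J : Finset S} (hJ : J.Nonempty) :
    ∃ h ∈ lowerSpan R (word (removeMin J)),
      tm q J = MonoidAlgebra.of R _ (word (removeMin J)) + h := by
  obtain ⟨x, hJx, hx⟩ := exists_eq_insert_of_nonempty hJ
  set J' := removeMin J
  have hcard : ∀ I ⊆ J', I.Nonempty → (J' \ I).card + 1 ≤ J'.card := fun I hI hne => by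
    have := Finset.card_sdiff_add_card_eq_card hI
    have := hne.card_pos
    omega
  have hempty : ∅ ∈ J'.powerset.filter (fun I => Even I.card) := by simp
  refine ⟨(tmEven q J' - tSet R J') - t R x * tm q J', sub_mem ?_ ?_, ?_⟩
  · rw [tmEven, ← Finset.add_sum_erase _ _ hempty]
    have h0 : ((-1 : R) ^ ell J' ∅ * (-q) ^ ((∅ : Finset S).card / 2)) • tSet R (J' \ ∅) =
        tSet R J' := by
      simp [ell]
    rw [h0, add_sub_cancel_left]
    refine sum_mem fun I hI => Submodule.smul_mem _ _ (of_mem_lowerSpan ?_)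
    obtain ⟨hI0, hI⟩ := Finset.mem_erase.1 hI
    have := hcard I (Finset.mem_powerset.1 (Finset.mem_filter.1 hI).1)
      (Finset.nonempty_iff_ne_empty.2 hI0)
    exact degLex_of_length_lt (by rw [length_toList_word, length_toList_word]; omega)
  · rw [tm, Finset.mul_sum]
    refine sum_mem fun I hI => ?_
    obtain ⟨hI, hodd⟩ := Finset.mem_filter.1 hI
    have hlt := of_mul_word_degLex hx (hcard I (Finset.mem_powerset.1 hI)
      (Finset.card_pos.1 hodd.pos))
    rw [mul_smul_comm, t, tSet, ← map_mul]
    exact Submodule.smul_mem _ _ (of_mem_lowerSpan hlt)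
  · conv_lhs => rw [hJx, tm_insert q hx]
    rw [show MonoidAlgebra.of R _ (word J') = tSet R J' from rfl]
    abel

/-- The leading monomials of the generators. -/
inductive IsGeneratorMonomial (𝔑 : Set (Finset S)) : FreeMonoid S → Prop
  | sq (s : S) : IsGeneratorMonomial 𝔑 (FreeMonoid.of s * FreeMonoid.of s)
  | swap {r s : S} (h : s < r) : IsGeneratorMonomial 𝔑 (FreeMonoid.of r * FreeMonoid.of s)
  | set {J : Finset S} (h : J ∈ 𝔑) : IsGeneratorMonomial 𝔑 (word (removeMin J))

variable {𝔑 : Set (Finset S)}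

theorem exists_eq_of_add_of_mem_generators (hne : ∀ J ∈ 𝔑, J.Nonempty) (q : R) {g : NCPoly R S}
    (hg : g ∈ generators q 𝔑) : ∃ m, IsGeneratorMonomial 𝔑 m ∧
      ∃ h ∈ lowerSpan R m, g = MonoidAlgebra.of R _ m + h := by
  obtain ((⟨s, rfl⟩ | ⟨r, s, hsr, rfl⟩) | ⟨J, hJ, rfl⟩) := hg
  · exact ⟨_, .sq s, t_sq_sub_eq q s⟩
  · exact ⟨_, .swap hsr, t_mul_add_mul_sub_eq q hsr⟩
  · exact ⟨_, .set hJ, tm_eq q (hne J hJ)⟩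

theorem IsGeneratorMonomial.exists_mem_generators (hne : ∀ J ∈ 𝔑, J.Nonempty) (q : R)
    {m : FreeMonoid S} (hm : IsGeneratorMonomial 𝔑 m) :
    ∃ g ∈ generators q 𝔑, ∃ h ∈ lowerSpan R m, g = MonoidAlgebra.of R _ m + h := by
  cases hm with
  | sq s => exact ⟨_, Or.inl (Or.inl ⟨s, rfl⟩), t_sq_sub_eq q s⟩
  | swap h => exact ⟨_, Or.inl (Or.inr ⟨_, _, h, rfl⟩), t_mul_add_mul_sub_eq q h⟩
  | set h => exact ⟨_, Or.inr ⟨_, h, rfl⟩, tm_eq q (hne _ h)⟩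

theorem isUnit_coeff_of_mem_generators [Nontrivial R] (hne : ∀ J ∈ 𝔑, J.Nonempty) (q : R)
    {g : NCPoly R S} (hg : g ∈ generators q 𝔑) {m : FreeMonoid S} (hm : IsLeadingMonomial g m) :
    IsUnit (g.coeff m) := by
  obtain ⟨m', -, h, hh, rfl⟩ := exists_eq_of_add_of_mem_generators hne q hg
  rw [hm.unique (isLeadingMonomial_of_add hh), coeff_of_add_self hh]
  exact isUnit_one

theorem mem_standardMonomials_generators [Nontrivial R] (hne : ∀ J ∈ 𝔑, J.Nonempty) (q : R)
    {w : FreeMonoid S} : w ∈ standardMonomials (generators q 𝔑) ↔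
      ∀ m, IsGeneratorMonomial 𝔑 m → ¬ ∃ a b, w = a * m * b := by
  constructor
  · intro hw m hm
    obtain ⟨g, hg, h, hh, rfl⟩ := hm.exists_mem_generators hne q
    exact hw _ hg m (isLeadingMonomial_of_add hh)
  · intro hw g hg m hm
    obtain ⟨m', hm', h, hh, rfl⟩ := exists_eq_of_add_of_mem_generators hne q hg
    rw [hm.unique (isLeadingMonomial_of_add hh)]
    exact hw m' hm'

theorem not_exists_word_eq_mul_of_le {r s : S} (h : s ≤ r) (J : Finset S) :
    ¬ ∃ a b, word J = a * (FreeMonoid.of r * FreeMonoid.of s) * b := by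
  rintro ⟨a, b, hab⟩
  have hsort := (J.sortedLT_sort).pairwise
  rw [← toList_word, hab, FreeMonoid.toList_mul, FreeMonoid.toList_mul, List.append_assoc] at hsort
  have := (List.pairwise_append.1 hsort).2.1
  exact absurd (List.rel_of_pairwise_cons this (List.mem_cons_self)) (not_lt.2 h)

/-- The words that avoid the leading monomials of the generators belonging to the Gröbner circuits
are the words of the sets without broken circuits. -/
theorem standardMonomials_generators_groebnerCircuits [Nontrivial R] [Finite S]
    {𝔐 : Set (Finset S)} (hne : ∀ C ∈ 𝔐, C.Nonempty) (q : R) :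
    standardMonomials (generators q (groebnerCircuits 𝔐)) =
      {w : FreeMonoid S | ∃ J, w = word J ∧ IsNbc 𝔐 J} := by
  have hne' : ∀ J ∈ groebnerCircuits 𝔐, J.Nonempty := fun J hJ =>
    (dependent_of_mem_groebnerCircuits hJ).nonempty hne
  ext w
  rw [mem_standardMonomials_generators hne' q]
  constructor
  · intro hw
    have hpair : (FreeMonoid.toList w).Pairwise (· < ·) := by
      rw [← List.isChain_iff_pairwise, List.isChain_iff_forall_rel_of_append_cons_cons]
      intro r s l₁ l₂ hl
      by_contra hrs
      have hfac : ∃ a b, w = a * (FreeMonoid.of r * FreeMonoid.of s) * b :=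
        ⟨FreeMonoid.ofList l₁, FreeMonoid.ofList l₂, FreeMonoid.toList.injective <| by
          rw [hl, FreeMonoid.toList_mul, FreeMonoid.toList_mul, List.append_assoc]; rfl⟩
      rcases (not_lt.1 hrs).eq_or_lt with rfl | hlt
      · exact hw _ (.sq _) hfac
      · exact hw _ (.swap hlt) hfac
    obtain ⟨J, rfl⟩ := exists_eq_word_of_pairwise_lt hpair
    refine ⟨J, rfl, ?_⟩
    by_contra hJ
    obtain ⟨K, hK, hKJ⟩ := exists_isGroebnerCircuit_of_not_isNbc hne hJ
    exact hw _ (.set hK) hKJ.exists_word_eq_mul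
  · rintro ⟨J, rfl, hJ⟩ m hm
    cases hm with
    | sq s => exact not_exists_word_eq_mul_of_le le_rfl J
    | swap h => exact not_exists_word_eq_mul_of_le h.le J
    | @set K hK =>
      rintro ⟨a, b, hab⟩
      refine hJ.not_removeMin_subset (dependent_of_mem_groebnerCircuits hK) fun x hx => ?_
      rw [← mem_toList_word, hab, FreeMonoid.toList_mul, FreeMonoid.toList_mul]
      exact List.mem_append_left _ (List.mem_append_right _ (mem_toList_word.2 hx))

/-- The generators belonging to the Gröbner circuits lie in the ideal, as the relations of all
dependent sets do. -/
theorem generators_groebnerCircuits_subset [Finite S] {𝔐 : Set (Finset S)}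
    (hne : ∀ C ∈ 𝔐, C.Nonempty) (q : R) :
    generators q (groebnerCircuits 𝔐) ⊆ {f | f ∈ idealQ q 𝔐} := by
  have hmem : ∀ g ∈ generators q 𝔐, g ∈ idealQ q 𝔐 := fun g hg => TwoSidedIdeal.subset_span hg
  set φ := (idealQ q 𝔐).ringCon.mkₐ R with hφ
  have hsq : ∀ s, φ (t R s) * φ (t R s) = algebraMap R _ q := fun s => by
    have := mkₐ_eq_zero_iff.2 (hmem _ (Or.inl (Or.inl ⟨s, rfl⟩)))
    rwa [map_sub, map_pow, AlgHom.commutes, sub_eq_zero, pow_two] at this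
  have hcomm : ∀ r s, φ (t R r) * φ (t R s) + φ (t R s) * φ (t R r) =
      algebraMap R _ (2 * q) := by
    have hlt : ∀ r s, s < r → φ (t R r) * φ (t R s) + φ (t R s) * φ (t R r) =
        algebraMap R _ (2 * q) := fun r s hsr => by
      have := mkₐ_eq_zero_iff.2 (hmem _ (Or.inl (Or.inr ⟨r, s, hsr, rfl⟩)))
      rwa [map_sub, map_add, map_mul, map_mul, AlgHom.commutes, sub_eq_zero] at this
    intro r s
    rcases lt_trichotomy s r with h | rfl | h
    · exact hlt r s h
    · rw [hsq, two_mul, map_add]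
    · rw [add_comm, hlt s r h]
  rintro g (hg | ⟨J, hJ, rfl⟩)
  · exact hmem g (Or.inl hg)
  · obtain ⟨C, hC, hCJ⟩ := dependent_of_mem_groebnerCircuits hJ
    exact mkₐ_eq_zero_iff.1 (map_tm_eq_zero_of_subset φ hsq hcomm (hne C hC) hCJ
      (mkₐ_eq_zero_iff.2 (hmem _ (Or.inr ⟨C, hC, rfl⟩))))

end Generators

end OSDeform

theorem corollary1p2 {R : Type*} [CommRing R] {S : Type*} [Finite S] [LinearOrder S]
    (M : Matroid S) (hE : M.E = Set.univ) (hloop : M.Loopless) (hpar : OSDeform.NoParallel M) :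
    (∃ n : ℕ, ∀ q : R,
      Module.Free R (OSDeform.OS q (OSDeform.circuits M)) ∧
      Module.rank R (OSDeform.OS q (OSDeform.circuits M)) = n) ∧
    (∀ q : R,
      OSDeform.IsGroebnerBasis
        (OSDeform.generators q (OSDeform.groebnerCircuits (OSDeform.circuits M)))
        (OSDeform.idealQ q (OSDeform.circuits M))) ∧
    (Nontrivial R → ∀ q : R,
      OSDeform.standardMonomials
        (OSDeform.generators q (OSDeform.groebnerCircuits (OSDeform.circuits M))) =
      {w : FreeMonoid S | ∃ J : Finset S, w = OSDeform.word J ∧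
        ∀ B : Finset S, OSDeform.IsBrokenCircuit (OSDeform.circuits M) B → ¬ B ⊆ J}) := by
  have hne : ∀ C ∈ OSDeform.circuits M, C.Nonempty := fun C hC =>
    Finset.coe_nonempty.1 (Matroid.IsCircuit.nonempty hC)
  have hsub := fun q : R => OSDeform.generators_groebnerCircuits_subset hne q
  cases subsingleton_or_nontrivial R with
  | inl hR =>
    have hA : Subsingleton (OSDeform.NCPoly R S) := Module.subsingleton R _
    have hOS : ∀ q : R, Subsingleton (OSDeform.OS q (OSDeform.circuits M)) := fun q =>
      Module.subsingleton R _
    refine ⟨⟨1, fun q => ⟨Module.Free.of_subsingleton R _, ?_⟩⟩, fun q => ⟨hsub q, ?_⟩,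
      fun h => absurd hR (not_subsingleton_iff_nontrivial.2 h)⟩
    · rw [rank_subsingleton, Nat.cast_one]
    · exact TwoSidedIdeal.ext fun x => by
        rw [Subsingleton.elim x 0]
        exact iff_of_true (TwoSidedIdeal.zero_mem _) (TwoSidedIdeal.zero_mem _)
  | inr hR =>
    have hstd := fun q : R =>
      OSDeform.standardMonomials_generators_groebnerCircuits (R := R) hne q
    have hunit := fun (q : R) g hg m hm =>
      OSDeform.isUnit_coeff_of_mem_generators (𝔑 := OSDeform.groebnerCircuits (OSDeform.circuits M))
        (fun J hJ => (OSDeform.dependent_of_mem_groebnerCircuits hJ).nonempty hne) q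
        (g := g) hg (m := m) hm
    have hind := fun (q : R) f (hf : f ∈ OSDeform.idealQ q (OSDeform.circuits M))
        (hsupp : ∀ w, f.coeff w ≠ 0 → w ∈ OSDeform.standardMonomials
          (OSDeform.generators q (OSDeform.groebnerCircuits (OSDeform.circuits M)))) =>
      OSDeform.eq_zero_of_mem_idealQ hE q hf fun w hw => by
        have := hsupp w hw
        rwa [hstd] at this
    refine ⟨⟨Nat.card {w : FreeMonoid S | ∃ J, w = OSDeform.word J ∧
      OSDeform.IsNbc (OSDeform.circuits M) J}, fun q => ?_⟩,
      fun q => OSDeform.isGroebnerBasis_of_independent (hsub q) (hunit q) (hind q),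
      fun _ q => hstd q⟩
    obtain ⟨b⟩ := OSDeform.nonempty_basis_standardMonomials (hsub q) (hunit q) (hind q)
    rw [hstd] at b
    have hfin : Finite {w : FreeMonoid S | ∃ J, w = OSDeform.word J ∧
        OSDeform.IsNbc (OSDeform.circuits M) J} :=
      ((Set.finite_range (OSDeform.word (S := S))).subset
        (by rintro _ ⟨J, rfl, -⟩; exact ⟨J, rfl⟩)).to_subtype
    have := Fintype.ofFinite {w : FreeMonoid S | ∃ J, w = OSDeform.word J ∧
        OSDeform.IsNbc (OSDeform.circuits M) J}
    exact ⟨Module.Free.of_basis b, by rw [rank_eq_card_basis b, Nat.card_eq_fintype_card]⟩
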